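/- A \emph{generalized triangulation} of a closed connected surface $X$ is an identification of $X$ with the quotient of finitely many triangles under a gluing of their sides in pairs (each side is glued to exactly one other side by an affine bijection; loops and multiple edges are allowed). Let $V,E,F$ be its sets of vertices, edges and triangles, $N=|V|$, $\chi(X)=|V|-|E|+|F|$, and let $\Phi:E\to[0,\pi/2]$ be a weight. A \emph{circle packing metric} is a function $r:V\to(0,\infty)$. It gives an edge with end points $i,j$ and weight $\Phi_{ij}$ the length $l_{ij}=\sqrt{r_i^2+r_j^2+2r_ir_j\cos\Phi_{ij}}$, and so makes every triangle $\{ijk\}$ a Euclidean triangle; let $\theta_i^{jk}$ be its inner angle at $i$, regarded as a function of the radii at the three corners. The combinatorial curvature at $i$ is $K_i=2\pi-\sum\theta_i^{jk}$, the sum being over all corners of triangles at $i$. A circle packing metric $r_{av}$ has \emph{constant curvature} if $K_i(r_{av})=2\pi\chi(X)/N$ for every $i\in V$. For an edge $ij$ with adjacent triangles $ijk$ and $ijl$ put $B_{ij}=r_j\,\partial(\theta_i^{jk}+\theta_i^{jl})/\partial r_j$ (if several edges join $i$ and $j$, their contributions are added). For $p>1$ and $f\in\mathbb R^V$ put $$\Delta_p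 f_i=\sum_{j\sim i}B_{ij}\,|f_j-f_i|^{p-2}(f_j-f_i),$$ where a term with $f_j=f_i$ is $0$. The \emph{combinatorial $p$-th Calabi flow in Euclidean background geometry} is the equation $$\frac{dr_i}{dt}=(\Delta_pK_i)\,r_i,\qquad i\in V,$$ for a curve $r(t)$ of circle packing metrics. \textbf{Theorem.} Let $(T,\Phi)$ be a generalized triangulation with weight $\Phi:E\to[0,\pi/2]$ of a closed connected surface $X$, let $p>1$, and let $r(0)\in\mathbb R_{>0}^V$ satisfy $\prod_{i\in V}r_i(0)=1$. Then the combinatorial $p$-th Calabi flow in Euclidean background geometry with initial value $r(0)$ has a solution for all $t\in[0,\infty)$, and every solution with this initial value on an interval $[0,\tau)$, $0<\tau<\infty$, extends to a solution on $[0,\infty)$. Moreover, every solution $r(t)$, $t\in[0,\infty)$, with this initial value converges in $\mathbb R_{>0}^V$ as $t\to\infty$ if and only if a constant curvature circle packing metric $r_{av}$ exists. -/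

import Mathlib

namespace CirclePacking

/-! ### Generalized triangulations of surfaces -/

/-- A directed side `(f, (a, b))` of a family `F` of triangles: the side of the triangle `f`
running from its corner `a` to its corner `b`. The corners of a triangle are labelled by `Fin 3`. -/
abbrev Side (F : Type*) : Type _ := F × {q : Fin 3 × Fin 3 // q.1 ≠ q.2}

namespace Side

variable {F : Type*}

/-- The corner at which a directed side starts. -/
def tail (s : Side F) : F × Fin 3 := (s.1, s.2.1.1)

/-- The corner at which a directed side ends. -/
def head (s : Side F) : F × Fin 3 := (s.1, s.2.1.2)

/-- The same side with the opposite direction. -/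
def reverse (s : Side F) : Side F := (s.1, ⟨(s.2.1.2, s.2.1.1), fun h => s.2.2 h.symm⟩)

/-- The side of the triangle `f` opposite to its corner `c`. -/
def opposite (f : F) (c : Fin 3) : Side F := (f, ⟨(c + 1, c + 2), by revert c; decide⟩)

/-- The point of the side at parameter `t ∈ [0, 1]`, in barycentric coordinates. -/
noncomputable def point (s : Side F) (t : ℝ) : Fin 3 → ℝ :=
  Pi.single s.2.1.1 (1 - t) + Pi.single s.2.1.2 t

end Side

/-- A pairwise gluing of the sides of a family `F` of triangles: every side is glued to exactly one
other side (possibly of the same triangle) along a bijection of their end points. -/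
structure TriangleGluing (F : Type*) where
  /-- the directed side to which a given directed side is glued -/
  glue : Side F → Side F
  glue_glue : ∀ s, glue (glue s) = s
  glue_reverse : ∀ s, glue s.reverse = (glue s).reverse
  glue_ne_self : ∀ s, glue s ≠ s
  glue_ne_reverse : ∀ s, glue s ≠ s.reverse

namespace TriangleGluing

variable {F : Type*} (T : TriangleGluing F)

/-- Two points of the disjoint union of the triangles are identified
when they correspond to each other on a pair of glued sides. -/
def PointRel (x y : Σ _ : F, stdSimplex ℝ (Fin 3)) : Prop :=
  ∃ s : Side F, ∃ t ∈ Set.Icc (0 : ℝ) 1,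
    x.1 = s.1 ∧ (x.2 : Fin 3 → ℝ) = s.point t ∧
    y.1 = (T.glue s).1 ∧ (y.2 : Fin 3 → ℝ) = (T.glue s).point t

/-- The surface obtained from the disjoint union of the triangles by gluing their sides,
with the quotient topology. -/
abbrev Realization : Type _ := Quot T.PointRel

/-- The vertices: corners of triangles modulo gluing. -/
def Vertex : Type _ :=
  Quot fun c d : F × Fin 3 => ∃ s : Side F, c = s.tail ∧ d = (T.glue s).tail

/-- The (undirected) edges: directed sides modulo gluing and reversal of the direction. -/
def Edge : Type _ := Quot fun s s' : Side F => s' = s.reverse ∨ s' = T.glue s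

/-- The vertex at a given corner of a triangle. -/
def vertex (c : F × Fin 3) : T.Vertex := Quot.mk _ c

/-- The edge underlying a directed side. -/
def edge (s : Side F) : T.Edge := Quot.mk _ s

instance [Finite F] : Finite T.Vertex := by unfold Vertex; infer_instance

instance [Finite F] : Finite T.Edge := by unfold Edge; infer_instance

noncomputable instance [Finite F] : Fintype T.Vertex := Fintype.ofFinite _

/-- The Euler characteristic `|V| - |E| + |F|`. -/
noncomputable def eulerChar : ℤ := (Nat.card T.Vertex : ℤ) - Nat.card T.Edge + Nat.card F

end TriangleGluing

/-- A generalized triangulation of a space `X` with set of triangles `F`: an identification of `X`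
with a surface glued from these triangles. Loops and multiple edges are allowed. -/
structure GeneralizedTriangulation (X : Type*) [TopologicalSpace X] (F : Type*)
    extends TriangleGluing F where
  homeo : X ≃ₜ toTriangleGluing.Realization

/-! ### Euclidean circle packing metrics -/

namespace TriangleGluing

variable {F : Type*} (T : TriangleGluing F)

/-- A circle packing metric is a positive function on the vertices. -/
def IsMetric (r : T.Vertex → ℝ) : Prop := ∀ v, 0 < r v

/-- The Euclidean length of the side opposite to the corner `c` of the triangle `f`, as a function
of the radii `x` at the three corners of `f`, for the edge weight `Φ`. -/
noncomputable def length (Φ : T.Edge → ℝ) (f : F) (x : Fin 3 → ℝ) (c : Fin 3) : ℝ :=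
  √(x (c + 1) ^ 2 + x (c + 2) ^ 2
    + 2 * x (c + 1) * x (c + 2) * Real.cos (Φ (T.edge (Side.opposite f c))))

/-- The inner angle at the corner `c` of the Euclidean triangle `f` (law of cosines), as a function
of the radii `x` at the three corners of `f`. -/
noncomputable def angle (Φ : T.Edge → ℝ) (f : F) (x : Fin 3 → ℝ) (c : Fin 3) : ℝ :=
  Real.arccos ((T.length Φ f x (c + 1) ^ 2 + T.length Φ f x (c + 2) ^ 2 - T.length Φ f x c ^ 2)
    / (2 * T.length Φ f x (c + 1) * T.length Φ f x (c + 2)))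

/-- The radii at the three corners of the triangle `f`. -/
def radii (r : T.Vertex → ℝ) (f : F) : Fin 3 → ℝ := fun c => r (T.vertex (f, c))

/-- For a directed side of a triangle `f` from corner `a` to corner `b`: the partial derivative
of the inner angle at `a` with respect to the radius at `b`. -/
noncomputable def angleDeriv (Φ : T.Edge → ℝ) (r : T.Vertex → ℝ) (s : Side F) : ℝ :=
  deriv (fun y => T.angle Φ s.1 (Function.update (T.radii r s.1) s.2.1.2 y) s.2.1.1)
    (T.radii r s.1 s.2.1.2)

/-- Adjacency of vertices: `i` and `j` are the end points of an edge. -/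
def Adj (i j : T.Vertex) : Prop := ∃ s : Side F, T.vertex s.tail = i ∧ T.vertex s.head = j

variable [Fintype F]

open Classical in
/-- The combinatorial Gauss curvature
`K_i = 2π - (sum of the inner angles of the triangles at the vertex i)`. -/
noncomputable def curvature (Φ : T.Edge → ℝ) (r : T.Vertex → ℝ) (i : T.Vertex) : ℝ :=
  2 * Real.pi - ∑ c : F × Fin 3 with T.vertex c = i, T.angle Φ c.1 (T.radii r c.1) c.2

open Classical in
/-- The coefficient `B_ij = r_j ∂(θ_i^{jk} + θ_i^{jl}) / ∂r_j`, where `ijk` and `ijl` are the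
triangles adjacent to the edge `ij`; if several edges join `i` and `j`, then the contributions of
all of them are added. -/
noncomputable def B (Φ : T.Edge → ℝ) (r : T.Vertex → ℝ) (i j : T.Vertex) : ℝ :=
  (∑ s : Side F with T.vertex s.tail = i ∧ T.vertex s.head = j, T.angleDeriv Φ r s) * r j

open Classical in
/-- The discrete `p`-Laplace operator
`Δ_p f_i = ∑_{j ∼ i} B_ij |f_j - f_i|^(p-2) (f_j - f_i)`. -/
noncomputable def pLaplacian (Φ : T.Edge → ℝ) (p : ℝ) (r f : T.Vertex → ℝ) (i : T.Vertex) : ℝ :=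
  ∑ j : T.Vertex with T.Adj i j, T.B Φ r i j * |f j - f i| ^ (p - 2) * (f j - f i)

/-- `r` is, on the time interval `I`, a solution of the combinatorial `p`-th Calabi flow
`dr_i/dt = (Δ_p K_i) r_i` in Euclidean background geometry (with values in the circle packing
metrics; the derivative is one-sided at end points belonging to `I`). -/
def IsCalabiFlowOn (Φ : T.Edge → ℝ) (p : ℝ) (I : Set ℝ) (r : ℝ → T.Vertex → ℝ) : Prop :=
  ∀ t ∈ I, T.IsMetric (r t) ∧ ∀ i,
    HasDerivWithinAt (fun s => r s i) (T.pLaplacian Φ p (r t) (T.curvature Φ (r t)) i * r t i) I t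

/-- A constant curvature circle packing metric: all curvatures equal `k_av = 2π χ(X) / |V|`. -/
def IsConstantCurvature (Φ : T.Edge → ℝ) (r : T.Vertex → ℝ) : Prop :=
  T.IsMetric r ∧
    ∀ i, T.curvature Φ r i = 2 * Real.pi * (T.eulerChar : ℝ) / (Nat.card T.Vertex : ℝ)

end TriangleGluing

end CirclePacking

/-!
In the logarithmic radii `u_i = log r_i` the flow is the autonomous equation
`u_i' = ∑_j B_ij |K_j - K_i|^(p-2) (K_j - K_i)` on the whole of `ℝ^V`.

Its analysis uses only that `K` is a curvature map (`IsCurvatureMap`): the derivative of `u ↦ K(u)`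
is the Laplacian of a connected graph with weights `B_ij = B_ji ≥ 0` that are continuous and bounded
in `u`, and `K` is bounded with constant sum.

* The velocity is continuous and bounded, but for `p < 2` not locally Lipschitz. Solutions on
  `[0, ∞)` therefore come from Peano's theorem (`exists_solution_of_continuous_of_bounded`), and
  solutions on `[0, τ)` are Lipschitz, so they can be continued (`exists_solution_extension`).
* Symmetry of the derivative makes `∑ (K_i - κ) du_i` a closed form, with a primitive `G`, the Ricci
  potential. It is strictly convex on hyperplanes `∑ u_i = const`, and grows at least linearly there
  if it has a critical point, that is, a metric of constant curvature
  (`exists_mul_norm_le_potential`). Along the flow `∑ u_i` is constant and `G` decreases at the rate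
  `½ ∑ B_ij |K_j - K_i|^p`, which vanishes only at the critical point. So the flow stays in a
  compact set and converges to the critical point (`tendsto_of_flow`).
* At a limit of the flow the velocity vanishes, so that the rate above vanishes and `K` is
  constant (`curv_eq_of_flow_tendsto`).

That the curvature of a circle packing is a curvature map is Thurston's computation of the
derivatives of the angles of one triangle (`hasFDerivAt_angle_of_radii`). An edge weight of a
triangle can vanish, namely when the circles at the ends of the edge are tangent and orthogonal to
the third one. This happens for at most one edge of a triangle (`edgeTerm_pos_of_edgeTerm_eq_zero`),
so the edges of positive weight still connect all vertices. The value `κ = 2πχ/N` of the average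
curvature is the combinatorial Gauss–Bonnet formula (`sum_curvature`).
-/

namespace CirclePacking

open Filter Topology Set

/-! ### Autonomous differential equations with bounded continuous right-hand side -/

section Peano

variable {E : Type*} [NormedAddCommGroup E] [NormedSpace ℝ E]

/-- The points of the explicit Euler scheme with step `h` for the equation `x' = v x`. -/
noncomputable def eulerSeq (v : E → E) (h : ℝ) (x₀ : E) : ℕ → E
  | 0 => x₀
  | n + 1 => eulerSeq v h x₀ n + h • v (eulerSeq v h x₀ n)

/-- As long as the velocities stay `ε`-close to `w`, the Euler scheme follows the line with
velocity `w` up to `ε` times the elapsed time. -/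
theorem norm_eulerSeq_sub_sub_le {v : E → E} {h : ℝ} (hh : 0 ≤ h) (x₀ w : E) {ε : ℝ} {k l : ℕ}
    (hkl : k ≤ l) (hw : ∀ j, k ≤ j → j ≤ l → ‖v (eulerSeq v h x₀ j) - w‖ ≤ ε) :
    ‖eulerSeq v h x₀ l - eulerSeq v h x₀ k - (h * l - h * k) • w‖ ≤ ε * (h * l - h * k) := by
  induction l, hkl using Nat.le_induction with
  | base => simp
  | succ l hkl ih =>
    have h1 := ih fun j hj hj' => hw j hj (by omega)
    have h2 := hw l hkl (by omega)
    have e : eulerSeq v h x₀ (l + 1) - eulerSeq v h x₀ k - (h * (l + 1 : ℕ) - h * k) • w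
        = (eulerSeq v h x₀ l - eulerSeq v h x₀ k - (h * l - h * k) • w)
          + h • (v (eulerSeq v h x₀ l) - w) := by
      simp only [eulerSeq]
      push_cast
      module
    rw [e]
    refine (norm_add_le _ _).trans ?_
    rw [norm_smul, Real.norm_of_nonneg hh]
    have := mul_le_mul_of_nonneg_left h2 hh
    push_cast
    linarith

theorem norm_eulerSeq_sub_le {v : E → E} {M : ℝ} (hM : ∀ x, ‖v x‖ ≤ M) {h : ℝ} (hh : 0 ≤ h)
    (x₀ : E) (k l : ℕ) :
    ‖eulerSeq v h x₀ l - eulerSeq v h x₀ k‖ ≤ M * |h * l - h * k| := by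
  wlog hkl : k ≤ l generalizing k l
  · rw [norm_sub_rev, abs_sub_comm]
    exact this l k (by omega)
  have := norm_eulerSeq_sub_sub_le hh x₀ (0 : E) hkl (ε := M) (v := v)
    fun j _ _ => by simpa using hM _
  have h0 : 0 ≤ h * l - h * k := by
    rw [← mul_sub]
    exact mul_nonneg hh (by simpa using hkl)
  rw [abs_of_nonneg h0]
  simpa using this

/-- The local version, forwards and backwards in time: within time `η` the scheme, which moves with
speed at most `M`, does not leave the ball on which `v` is `ε`-close to `w`. -/
theorem norm_eulerSeq_sub_sub_le_of_close {v : E → E} {M : ℝ} (hM : ∀ x, ‖v x‖ ≤ M) {h : ℝ}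
    (hh : 0 ≤ h) (x₀ w y : E) {ε δ η : ℝ} (k l : ℕ)
    (hw : ∀ x, ‖x - y‖ < δ → ‖v x - w‖ ≤ ε) (hk : ‖eulerSeq v h x₀ k - y‖ + M * η < δ)
    (hη : |h * l - h * k| ≤ η) :
    ‖eulerSeq v h x₀ l - eulerSeq v h x₀ k - (h * l - h * k) • w‖ ≤ ε * |h * l - h * k| := by
  have hM0 : 0 ≤ M := (norm_nonneg _).trans (hM 0)
  have key : ∀ j : ℕ, |h * j - h * k| ≤ |h * l - h * k| →
      ‖v (eulerSeq v h x₀ j) - w‖ ≤ ε := by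
    intro j hj
    apply hw
    have h1 := norm_eulerSeq_sub_le hM hh x₀ k j
    have h2 : M * |h * j - h * k| ≤ M * η := mul_le_mul_of_nonneg_left (hj.trans hη) hM0
    have h3 := norm_sub_le_norm_sub_add_norm_sub (eulerSeq v h x₀ j) (eulerSeq v h x₀ k) y
    linarith
  rcases le_total k l with hkl | hkl
  · have h0 : ∀ j : ℕ, k ≤ j → 0 ≤ h * j - h * k := fun j hj => by
      rw [← mul_sub]
      exact mul_nonneg hh (by simpa using hj)
    have := norm_eulerSeq_sub_sub_le (v := v) hh x₀ w hkl (ε := ε) fun j hj hj' => key j (by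
      rw [abs_of_nonneg (h0 j hj), abs_of_nonneg (h0 l hkl)]
      have : h * j ≤ h * l := mul_le_mul_of_nonneg_left (by exact_mod_cast hj') hh
      linarith)
    rwa [abs_of_nonneg (h0 l hkl)]
  · have h0 : ∀ j : ℕ, j ≤ k → h * j - h * k ≤ 0 := fun j hj => by
      have : h * j ≤ h * k := mul_le_mul_of_nonneg_left (by exact_mod_cast hj) hh
      linarith
    have := norm_eulerSeq_sub_sub_le (v := v) hh x₀ w hkl (ε := ε) fun j hj hj' => key j (by
      rw [abs_of_nonpos (h0 j hj'), abs_of_nonpos (h0 l hkl)]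
      have : h * l ≤ h * j := mul_le_mul_of_nonneg_left (by exact_mod_cast hj) hh
      linarith)
    have e : eulerSeq v h x₀ l - eulerSeq v h x₀ k - (h * l - h * k) • w
        = -(eulerSeq v h x₀ k - eulerSeq v h x₀ l - (h * k - h * l) • w) := by module
    rw [abs_of_nonpos (h0 l hkl), neg_sub, e, norm_neg]
    exact this

theorem tendsto_mul_floor_div {h : ℕ → ℝ} (hpos : ∀ n, 0 < h n) {l : Filter ℕ}
    (hlim : Tendsto h l (𝓝 0)) {t : ℝ} (ht : 0 ≤ t) :
    Tendsto (fun n => h n * (⌊t / h n⌋₊ : ℕ)) l (𝓝 t) := by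
  have h1 : Tendsto (fun n => t - h n) l (𝓝 t) := by simpa using hlim.const_sub t
  refine tendsto_of_tendsto_of_tendsto_of_le_of_le h1 tendsto_const_nhds (fun n => ?_) fun n => ?_
  · have h2 := Nat.lt_floor_add_one (t / h n)
    rw [div_lt_iff₀ (hpos n)] at h2
    dsimp only
    linarith
  · have h2 := Nat.floor_le (div_nonneg ht (hpos n).le)
    rw [le_div_iff₀ (hpos n)] at h2
    dsimp only
    linarith

/-- **Peano's existence theorem**, global form: an autonomous equation with bounded continuous
right-hand side has a solution on `[0, ∞)` through every point. The solution is a limit of Euler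
step functions along an ultrafilter; it is differentiable since the difference quotients of the
approximations are close to `v (u s)` near `s`, uniformly in the approximation. -/
theorem exists_solution_of_continuous_of_bounded [ProperSpace E] {v : E → E} (hv : Continuous v)
    {M : ℝ} (hM : ∀ x, ‖v x‖ ≤ M) (x₀ : E) :
    ∃ u : ℝ → E, u 0 = x₀ ∧ ∀ t ∈ Ici (0 : ℝ), HasDerivWithinAt u (v (u t)) (Ici 0) t := by
  have hM0 : 0 ≤ M := (norm_nonneg _).trans (hM 0)
  let 𝓤 : Ultrafilter ℕ := hyperfilter ℕ
  let h : ℕ → ℝ := fun n => 1 / ((n : ℝ) + 1)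
  have hpos : ∀ n, 0 < h n := fun n => by positivity
  have hlim : Tendsto h 𝓤 (𝓝 0) :=
    tendsto_one_div_add_atTop_nhds_zero_nat.mono_left Nat.hyperfilter_le_atTop
  let U : ℕ → ℝ → E := fun n t => eulerSeq v (h n) x₀ ⌊t / h n⌋₊
  have hU : ∀ t, 0 ≤ t → ∃ y, Tendsto (fun n => U n t) 𝓤 (𝓝 y) := by
    intro t ht
    have hmem : ∀ n, U n t ∈ Metric.closedBall x₀ (M * t) := by
      intro n
      have h1 := norm_eulerSeq_sub_le hM (hpos n).le x₀ 0 ⌊t / h n⌋₊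
      have h2 := Nat.floor_le (div_nonneg ht (hpos n).le)
      rw [le_div_iff₀ (hpos n)] at h2
      rw [mem_closedBall_iff_norm]
      refine h1.trans ?_
      have h3 : 0 ≤ h n * (⌊t / h n⌋₊ : ℝ) := by have := hpos n; positivity
      simp only [Nat.cast_zero, mul_zero, sub_zero, abs_of_nonneg h3]
      exact mul_le_mul_of_nonneg_left (by linarith) hM0
    obtain ⟨y, -, hy⟩ := (isCompact_closedBall x₀ (M * t)).ultrafilter_le_nhds
      (𝓤.map fun n => U n t) (by
        rw [le_principal_iff]
        exact Eventually.of_forall (f := (𝓤 : Filter ℕ)) hmem)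
    exact ⟨y, hy⟩
  choose! u hu using hU
  refine ⟨u, ?_, ?_⟩
  · have h1 := hu 0 le_rfl
    have h2 : (fun n => U n 0) = fun _ => x₀ := by
      funext n
      simp [U, eulerSeq]
    rw [h2] at h1
    exact tendsto_nhds_unique h1 tendsto_const_nhds
  · intro s hs
    have hs : 0 ≤ s := hs
    rw [hasDerivWithinAt_iff_isLittleO, Asymptotics.isLittleO_iff]
    intro ε hε
    obtain ⟨δ, hδ, hvδ⟩ := Metric.continuous_iff.1 hv (u s) ε hε
    -- starting within `δ / 2` of `u s`, the schemes stay within `δ` of it for time `η`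
    obtain ⟨η, hη, hηδ⟩ : ∃ η > 0, M * η < δ / 2 := by
      refine ⟨δ / (2 * (M + 1)), by positivity, ?_⟩
      rw [← mul_div_assoc, div_lt_div_iff₀ (by positivity) (by positivity)]
      nlinarith
    have hnear : ∀ᶠ t in 𝓝[Ici 0] s, |t - s| < η := by
      have : ∀ᶠ t in 𝓝 s, |t - s| < η := Metric.ball_mem_nhds s hη
      exact this.filter_mono nhdsWithin_le_nhds
    filter_upwards [hnear, self_mem_nhdsWithin] with t hts ht
    have ht : 0 ≤ t := ht
    have hτ : Tendsto (fun n => h n * (⌊t / h n⌋₊ : ℝ) - h n * (⌊s / h n⌋₊ : ℝ)) 𝓤 (𝓝 (t - s)) :=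
      (tendsto_mul_floor_div hpos hlim ht).sub (tendsto_mul_floor_div hpos hlim hs)
    refine le_of_tendsto_of_tendsto
      (((hu t ht).sub (hu s hs)).sub (hτ.smul_const (v (u s)))).norm (hτ.abs.const_mul ε) ?_
    have e1 := hτ.abs.eventually_lt_const hts
    have e2 : ∀ᶠ n in (𝓤 : Filter ℕ), ‖U n s - u s‖ < δ / 2 := by
      simpa [dist_eq_norm] using (hu s hs).eventually (Metric.ball_mem_nhds (u s) (half_pos hδ))
    filter_upwards [e1, e2] with n h1 h2
    refine norm_eulerSeq_sub_sub_le_of_close hM (hpos n).le x₀ (v (u s)) (u s) (δ := δ) (η := η)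
      _ _ (fun x hx => ?_) ?_ h1.le
    · have := hvδ x (by rwa [dist_eq_norm])
      rw [dist_eq_norm] at this
      exact this.le
    · change ‖U n s - u s‖ + _ < _
      linarith

/-- A solution on `[0, τ)` of an equation with bounded continuous right-hand side is Lipschitz, so
it has a limit at `τ`, from which it is continued by Peano's theorem. -/
theorem exists_solution_extension {ι : Type*} [Fintype ι] {v : (ι → ℝ) → ι → ℝ}
    (hv : Continuous v) {M : ℝ} (hM : ∀ x, ‖v x‖ ≤ M) {τ : ℝ} (hτ : 0 < τ) {u : ℝ → ι → ℝ}
    (hu : ∀ t ∈ Ico 0 τ, HasDerivWithinAt u (v (u t)) (Ico 0 τ) t) :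
    ∃ w : ℝ → ι → ℝ, EqOn w u (Ico 0 τ) ∧
      ∀ t ∈ Ici (0 : ℝ), HasDerivWithinAt w (v (w t)) (Ici 0) t := by
  have hM0 : 0 ≤ M := (norm_nonneg _).trans (hM 0)
  have hlip : LipschitzOnWith ⟨M, hM0⟩ u (Ico 0 τ) :=
    (convex_Ico 0 τ).lipschitzOnWith_of_nnnorm_hasDerivWithin_le hu fun x _ => hM _
  obtain ⟨g, hg, hgu⟩ := hlip.extend_pi
  obtain ⟨z, hz0, hz⟩ := exists_solution_of_continuous_of_bounded hv hM (g τ)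
  let w : ℝ → ι → ℝ := fun t => if t < τ then g t else z (t - τ)
  have hwτ : w τ = g τ := by simp [w, hz0]
  have hwlt : ∀ t < τ, w t = g t := fun t ht => by simp [w, ht]
  have hwge : ∀ t, τ ≤ t → w t = z (t - τ) := fun t ht => by simp [w, not_lt.2 ht]
  have hwle : ∀ t ≤ τ, w t = g t := fun t ht => by
    rcases ht.lt_or_eq with h | rfl
    exacts [hwlt t h, hwτ]
  have hwu : EqOn w u (Ico 0 τ) := fun t ht => by rw [hwlt t ht.2, hgu ht]
  refine ⟨w, hwu, ?_⟩
  have hleft : ∀ t ∈ Ico 0 τ, HasDerivWithinAt w (v (w t)) (Ici 0) t := by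
    intro t ht
    have h1 : HasDerivWithinAt w (v (w t)) (Ico 0 τ) t := by
      rw [hwu ht]
      exact (hu t ht).congr hwu (hwu ht)
    refine h1.mono_of_mem_nhdsWithin ?_
    rw [← Ici_inter_Iio]
    exact inter_mem self_mem_nhdsWithin (mem_nhdsWithin_of_mem_nhds (Iio_mem_nhds ht.2))
  have hright : ∀ t, τ ≤ t → HasDerivWithinAt w (v (w t)) (Ici τ) t := by
    intro t ht
    have h1 : HasDerivWithinAt (fun s => z (s - τ)) (v (z (t - τ))) (Ici τ) t := by
      have h2 := (hz (t - τ) (by simpa using ht)).scomp t (s := Ici τ)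
        ((hasDerivAt_id t).sub_const τ).hasDerivWithinAt (fun x hx => by simpa using hx)
      simpa [Function.comp_def] using h2
    rw [hwge t ht]
    exact h1.congr (fun s hs => hwge s hs) (hwge t ht)
  intro t ht
  rcases lt_trichotomy t τ with h | rfl | h
  · exact hleft t ⟨ht, h⟩
  · have hcont : ContinuousWithinAt w (Iic t) t :=
      hg.continuous.continuousWithinAt.congr (fun s hs => hwle s hs) hwτ
    have hint : ∀ s ∈ Ioo 0 t, HasDerivAt w (v (w s)) s := fun s hs =>
      (hleft s ⟨hs.1.le, hs.2⟩).hasDerivAt (Ici_mem_nhds hs.1)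
    have hmem : Ioo 0 t ∈ 𝓝[<] t := Ioo_mem_nhdsLT hτ
    have hL : HasDerivWithinAt w (v (w t)) (Iic t) t := by
      refine hasDerivWithinAt_Iic_of_tendsto_deriv (s := Ioo 0 t)
        (fun s hs => (hint s hs).differentiableAt.differentiableWithinAt)
        (hcont.mono fun s hs => hs.2.le) hmem ?_
      have h1 : Tendsto (fun s => v (w s)) (𝓝[<] t) (𝓝 (v (w t))) :=
        (hv.tendsto _).comp (hcont.mono Iio_subset_Iic_self)
      refine h1.congr' ?_
      filter_upwards [hmem] with s hs using (hint s hs).deriv.symm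
    have := hL.union (hright t le_rfl)
    exact this.mono fun s _ => le_total s t
  · exact ((hright t h.le).hasDerivAt (Ici_mem_nhds h)).hasDerivWithinAt

end Peano

/-! ### The odd power function -/

/-- The odd power function `x ↦ |x|^(p-2) x`, with value `0` at `0` for every `p`. -/
noncomputable def signedPow (p x : ℝ) : ℝ := |x| ^ (p - 2) * x

theorem signedPow_neg (p x : ℝ) : signedPow p (-x) = -signedPow p x := by
  simp [signedPow]

theorem abs_signedPow {p : ℝ} (hp : 1 < p) (x : ℝ) : |signedPow p x| = |x| ^ (p - 1) := by
  rcases eq_or_ne x 0 with rfl | hx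
  · simp [signedPow, Real.zero_rpow (by linarith : p - 1 ≠ 0)]
  · have h : 0 < |x| := abs_pos.2 hx
    rw [signedPow, abs_mul, abs_of_nonneg (by positivity : 0 ≤ |x| ^ (p - 2)),
      ← Real.rpow_add_one h.ne']
    ring_nf

theorem signedPow_mul_self_nonneg (p x : ℝ) : 0 ≤ signedPow p x * x := by
  rw [signedPow, mul_assoc]
  exact mul_nonneg (by positivity) (mul_self_nonneg x)

theorem signedPow_mul_self_eq_zero_iff {p x : ℝ} : signedPow p x * x = 0 ↔ x = 0 := by
  refine ⟨fun h => ?_, fun h => by simp [h]⟩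
  by_contra hx
  have h1 : 0 < |x| ^ (p - 2) := Real.rpow_pos_of_pos (abs_pos.2 hx) _
  simp [signedPow, hx, h1.ne'] at h

theorem continuous_signedPow {p : ℝ} (hp : 1 < p) : Continuous (signedPow p) := by
  rw [continuous_iff_continuousAt]
  intro x
  rcases eq_or_ne x 0 with rfl | hx
  · have h1 : Tendsto (fun y : ℝ => |y| ^ (p - 1)) (𝓝 0) (𝓝 0) := by
      have : Continuous fun y : ℝ => |y| ^ (p - 1) :=
        continuous_abs.rpow_const fun _ => Or.inr (by linarith)
      simpa [Real.zero_rpow (by linarith : p - 1 ≠ 0)] using this.tendsto 0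
    have h0 : signedPow p 0 = 0 := by simp [signedPow]
    rw [ContinuousAt, h0, tendsto_zero_iff_abs_tendsto_zero]
    exact h1.congr fun y => (abs_signedPow hp y).symm
  · exact (continuous_abs.continuousAt.rpow_const (Or.inl (abs_ne_zero.2 hx))).mul continuousAt_id

/-! ### Curvature maps with Laplacian derivative -/

theorem sum_mul_sum_of_antisymm {V : Type*} [Fintype V] (f : V → ℝ) {a : V → V → ℝ}
    (ha : ∀ i j, a i j = -a j i) :
    ∑ i, f i * ∑ j, a i j = -(1 / 2) * ∑ i, ∑ j, a i j * (f j - f i) := by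
  have h1 : ∑ i, ∑ j, a i j * f j = -∑ i, ∑ j, a i j * f i := by
    rw [Finset.sum_comm, ← Finset.sum_neg_distrib]
    refine Finset.sum_congr rfl fun i _ => ?_
    rw [← Finset.sum_neg_distrib]
    refine Finset.sum_congr rfl fun j _ => ?_
    rw [ha j i]
    ring
  have h2 : ∑ i, f i * ∑ j, a i j = ∑ i, ∑ j, a i j * f i := by
    simp only [Finset.mul_sum, mul_comm]
  simp only [mul_sub, Finset.sum_sub_distrib, h1, h2]
  ring

/-- If a function and its derivative converge at infinity, the derivative converges to `0`. -/
theorem eq_zero_of_tendsto_of_tendsto_deriv {f f' : ℝ → ℝ} {L c : ℝ}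
    (hf : ∀ t, 0 < t → HasDerivAt f (f' t) t) (hL : Tendsto f atTop (𝓝 L))
    (hc : Tendsto f' atTop (𝓝 c)) : c = 0 := by
  have h1 : ∀ t : ℝ, ∃ ξ, t ≤ ξ ∧ (0 < t → f' ξ = f (t + 1) - f t) := by
    intro t
    by_cases ht : 0 < t
    · obtain ⟨ξ, hξ, h2⟩ := exists_hasDerivAt_eq_slope f f' (lt_add_one t)
        (fun s hs => (hf s (ht.trans_le hs.1)).continuousAt.continuousWithinAt)
        (fun s hs => hf s (ht.trans hs.1))
      exact ⟨ξ, hξ.1.le, fun _ => by simpa using h2⟩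
    · exact ⟨t, le_rfl, fun h => absurd h ht⟩
  choose ξ hξ hξ' using h1
  have h2 : Tendsto (fun t => f' (ξ t)) atTop (𝓝 c) :=
    hc.comp (tendsto_atTop_mono hξ tendsto_id)
  have h3 : Tendsto (fun t => f (t + 1) - f t) atTop (𝓝 (L - L)) :=
    (hL.comp (tendsto_atTop_add_const_right _ 1 tendsto_id)).sub hL
  rw [sub_self] at h3
  refine tendsto_nhds_unique (h2.congr' ?_) h3
  filter_upwards [eventually_gt_atTop 0] with t ht using hξ' t ht

/-- A map `K` on `ℝ^V` whose derivative at every point is the Laplacian (with the sign making it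
positive semidefinite) of a connected weighted graph on `V`, with weights `B` depending
continuously on the point. Combinatorial curvatures, as functions of the logarithms of the radii,
have this form; `κ` is the average of `K`. -/
structure IsCurvatureMap {V : Type*} [Fintype V] (K : (V → ℝ) → V → ℝ) (B : (V → ℝ) → V → V → ℝ)
    (κ : ℝ) : Prop where
  symm : ∀ u i j, B u i j = B u j i
  nonneg : ∀ u i j, 0 ≤ B u i j
  continuous : ∀ i j, Continuous fun u => B u i j
  bounded : ∃ C, ∀ u i j, B u i j ≤ C
  connected : ∀ u (f : V → ℝ), (∀ i j, 0 < B u i j → f i = f j) → ∀ i j, f i = f j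
  bounded_curv : ∃ C, ∀ u i, |K u i| ≤ C
  sum_curv : ∀ u, ∑ i, K u i = Fintype.card V * κ
  hasFDerivAt : ∀ u i, HasFDerivAt (fun u => K u i)
    (-∑ j, B u i j • (ContinuousLinearMap.proj (R := ℝ) (φ := fun _ : V => ℝ) j
      - ContinuousLinearMap.proj i)) u

/-- The velocity `u_i' = ∑_j B_ij |K_j - K_i|^(p-2) (K_j - K_i)` of the `p`-th Calabi flow. -/
noncomputable def calabiField {V : Type*} [Fintype V] (K : (V → ℝ) → V → ℝ)
    (B : (V → ℝ) → V → V → ℝ) (p : ℝ) (u : V → ℝ) (i : V) : ℝ :=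
  ∑ j, B u i j * signedPow p (K u j - K u i)

/-- Up to the sign, the rate of change of the Ricci potential along the `p`-th Calabi flow. -/
noncomputable def dissipation {V : Type*} [Fintype V] (K : (V → ℝ) → V → ℝ)
    (B : (V → ℝ) → V → V → ℝ) (p : ℝ) (u : V → ℝ) : ℝ :=
  1 / 2 * ∑ i, ∑ j, B u i j * (signedPow p (K u j - K u i) * (K u j - K u i))

namespace IsCurvatureMap

variable {V : Type*} [Fintype V] {K : (V → ℝ) → V → ℝ} {B : (V → ℝ) → V → V → ℝ} {κ : ℝ}

section Field

variable {p : ℝ}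

theorem continuous_curv (h : IsCurvatureMap K B κ) (i : V) : Continuous fun u => K u i :=
  continuous_iff_continuousAt.2 fun u => (h.hasFDerivAt u i).continuousAt

theorem continuous_calabiField (h : IsCurvatureMap K B κ) (hp : 1 < p) :
    Continuous (calabiField K B p) :=
  continuous_pi fun i => continuous_finsetSum _ fun j _ => (h.continuous i j).mul
    ((continuous_signedPow hp).comp ((h.continuous_curv j).sub (h.continuous_curv i)))

theorem continuous_dissipation (h : IsCurvatureMap K B κ) (hp : 1 < p) :
    Continuous (dissipation K B p) :=
  continuous_const.mul <| continuous_finsetSum _ fun i _ => continuous_finsetSum _ fun j _ =>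
    (h.continuous i j).mul <|
      ((continuous_signedPow hp).comp ((h.continuous_curv j).sub (h.continuous_curv i))).mul
        ((h.continuous_curv j).sub (h.continuous_curv i))

theorem exists_norm_calabiField_le (h : IsCurvatureMap K B κ) (hp : 1 < p) :
    ∃ M, ∀ u, ‖calabiField K B p u‖ ≤ M := by
  obtain ⟨C, hC⟩ := h.bounded
  obtain ⟨C', hC'⟩ := h.bounded_curv
  refine ⟨∑ _j : V, |C| * (|C'| + |C'|) ^ (p - 1), fun u => ?_⟩
  refine (pi_norm_le_iff_of_nonneg (by positivity)).2 fun i => ?_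
  refine (Finset.abs_sum_le_sum_abs _ _).trans (Finset.sum_le_sum fun j _ => ?_)
  rw [abs_mul, abs_signedPow hp, abs_of_nonneg (h.nonneg u i j)]
  have h1 : |K u j - K u i| ≤ |C'| + |C'| :=
    (abs_sub _ _).trans (add_le_add ((hC' u j).trans (le_abs_self _))
      ((hC' u i).trans (le_abs_self _)))
  exact mul_le_mul ((hC u i j).trans (le_abs_self _))
    (Real.rpow_le_rpow (abs_nonneg _) h1 (by linarith)) (by positivity) (abs_nonneg _)

theorem sum_mul_calabiField (h : IsCurvatureMap K B κ) (p : ℝ) (u f : V → ℝ) :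
    ∑ i, f i * calabiField K B p u i
      = -(1 / 2) * ∑ i, ∑ j, B u i j * signedPow p (K u j - K u i) * (f j - f i) :=
  sum_mul_sum_of_antisymm f fun i j => by
    rw [h.symm u i j, ← neg_sub (K u i), signedPow_neg]
    ring

theorem sum_calabiField (h : IsCurvatureMap K B κ) (p : ℝ) (u : V → ℝ) :
    ∑ i, calabiField K B p u i = 0 := by
  simpa using h.sum_mul_calabiField p u fun _ => 1

theorem sum_curv_mul_calabiField (h : IsCurvatureMap K B κ) (p : ℝ) (u : V → ℝ) :
    ∑ i, (K u i - κ) * calabiField K B p u i = -dissipation K B p u := by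
  rw [h.sum_mul_calabiField p u fun i => K u i - κ, dissipation]
  simp only [sub_sub_sub_cancel_right, mul_assoc]
  ring

theorem dissipation_nonneg (h : IsCurvatureMap K B κ) (p : ℝ) (u : V → ℝ) :
    0 ≤ dissipation K B p u :=
  mul_nonneg (by norm_num) <| Finset.sum_nonneg fun i _ => Finset.sum_nonneg fun j _ =>
    mul_nonneg (h.nonneg u i j) (signedPow_mul_self_nonneg p _)

theorem eq_of_forall_eq (h : IsCurvatureMap K B κ) {u : V → ℝ} (hK : ∀ i j, K u i = K u j)
    (i : V) : K u i = κ := by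
  have h1 : (Fintype.card V : ℝ) * K u i = Fintype.card V * κ := by
    rw [← h.sum_curv u, Finset.sum_congr rfl fun j _ => hK j i]
    simp
  have : Nonempty V := ⟨i⟩
  exact mul_left_cancel₀ (by positivity) h1

theorem curv_eq_of_dissipation_eq_zero (h : IsCurvatureMap K B κ) {u : V → ℝ}
    (hu : dissipation K B p u = 0) (i : V) : K u i = κ := by
  refine h.eq_of_forall_eq (h.connected u _ fun i j hij => ?_) i
  have h0 : ∀ i j, 0 ≤ B u i j * (signedPow p (K u j - K u i) * (K u j - K u i)) := fun i j =>
    mul_nonneg (h.nonneg u i j) (signedPow_mul_self_nonneg p _)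
  have h1 : ∑ i, ∑ j, B u i j * (signedPow p (K u j - K u i) * (K u j - K u i)) = 0 := by
    simpa [dissipation] using hu
  rw [Finset.sum_eq_zero_iff_of_nonneg fun i _ => Finset.sum_nonneg fun j _ => h0 i j] at h1
  have h2 := h1 i (Finset.mem_univ i)
  rw [Finset.sum_eq_zero_iff_of_nonneg fun j _ => h0 i j] at h2
  have h3 := (mul_eq_zero.1 (h2 j (Finset.mem_univ j))).resolve_left hij.ne'
  rw [signedPow_mul_self_eq_zero_iff, sub_eq_zero] at h3
  exact h3.symm

theorem curv_eq_of_calabiField_eq_zero (h : IsCurvatureMap K B κ) {u : V → ℝ}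
    (hu : calabiField K B p u = 0) (i : V) : K u i = κ := by
  refine h.curv_eq_of_dissipation_eq_zero (p := p) ?_ i
  have := h.sum_curv_mul_calabiField p u
  simp only [hu, Pi.zero_apply, mul_zero, Finset.sum_const_zero] at this
  linarith

end Field

/-! ### The Ricci potential -/

theorem sum_mul_fderiv (h : IsCurvatureMap K B κ) (u x y : V → ℝ) :
    ∑ i, y i * -∑ j, B u i j * (x j - x i)
      = 1 / 2 * ∑ i, ∑ j, B u i j * (x j - x i) * (y j - y i) := by
  have := sum_mul_sum_of_antisymm (a := fun i j => B u i j * (x j - x i)) y fun i j => by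
    rw [h.symm u i j]
    ring
  simp only [mul_neg, Finset.sum_neg_distrib, this]
  ring

/-- The Ricci potential: the form `∑ (K_i - κ) du_i` is closed, since the derivative of `K` is a
symmetric matrix, hence exact. -/
theorem exists_potential (h : IsCurvatureMap K B κ) : ∃ G : (V → ℝ) → ℝ, ∀ u,
    HasFDerivAt G (∑ i, (K u i - κ) • ContinuousLinearMap.proj (R := ℝ) (φ := fun _ : V => ℝ) i)
      u := by
  have hω : ∀ u, HasFDerivAt
      (fun u => ∑ i, (K u i - κ) • ContinuousLinearMap.proj (R := ℝ) (φ := fun _ : V => ℝ) i)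
      (∑ i, (-∑ j, B u i j • (ContinuousLinearMap.proj (R := ℝ) (φ := fun _ : V => ℝ) j
        - ContinuousLinearMap.proj i)).smulRight
          (ContinuousLinearMap.proj (R := ℝ) (φ := fun _ : V => ℝ) i)) u := fun u =>
    HasFDerivAt.fun_sum fun i _ => ((h.hasFDerivAt u i).sub_const κ).smul_const
      (ContinuousLinearMap.proj (R := ℝ) (φ := fun _ : V => ℝ) i)
  obtain ⟨G, hG⟩ := convex_univ.exists_forall_hasFDerivWithinAt_of_hasFDerivWithinAt_symmetric
    (fun u _ => (hω u).hasFDerivWithinAt) (by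
      intro u _ x _ y _
      have e : ∀ x y : V → ℝ, (∑ i, (-∑ j, B u i j • (ContinuousLinearMap.proj (R := ℝ)
          (φ := fun _ : V => ℝ) j - ContinuousLinearMap.proj i)).smulRight
          (ContinuousLinearMap.proj (R := ℝ) (φ := fun _ : V => ℝ) i)) x y
          = 1 / 2 * ∑ i, ∑ j, B u i j * (x j - x i) * (y j - y i) := by
        intro x y
        rw [← h.sum_mul_fderiv]
        simp [sum_apply, mul_comm]
      rw [e, e]
      simp only [mul_right_comm])
  exact ⟨G, fun u => (hG u (mem_univ u)).hasFDerivAt univ_mem⟩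

variable {a : V → ℝ} {G : (V → ℝ) → ℝ}

/-- Strict monotonicity of the curvature along lines in non-constant directions: the derivative
is the Dirichlet energy of the direction. -/
theorem strictMono_sum_mul_curv (h : IsCurvatureMap K B κ) (a : V → ℝ) {w : V → ℝ}
    (hw : ∑ i, w i = 0) (hw0 : w ≠ 0) :
    StrictMono fun s : ℝ => ∑ i, (K (a + s • w) i - κ) * w i := by
  have hline : ∀ s : ℝ, HasDerivAt (fun s : ℝ => a + s • w) w s := fun s => by
    simpa using ((hasDerivAt_id s).smul_const w).const_add a
  refine strictMono_of_hasDerivAt_pos (f' := fun s =>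
    ∑ i, w i * -∑ j, B (a + s • w) i j * (w j - w i)) (fun s => ?_) fun s => ?_
  · refine HasDerivAt.fun_sum fun i _ => ?_
    have h1 := ((h.hasFDerivAt (a + s • w) i).comp_hasDerivAt s (hline s)).sub_const κ
    have h2 := h1.mul_const (w i)
    simpa [sum_apply, mul_comm] using h2
  · rw [h.sum_mul_fderiv]
    have h0 : ∀ i j, 0 ≤ B (a + s • w) i j * (w j - w i) * (w j - w i) := fun i j => by
      rw [mul_assoc]
      exact mul_nonneg (h.nonneg _ i j) (mul_self_nonneg _)
    refine mul_pos (by norm_num) (lt_of_le_of_ne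
      (Finset.sum_nonneg fun i _ => Finset.sum_nonneg fun j _ => h0 i j) fun h1 => hw0 ?_)
    have hconst : ∀ i j, w i = w j := by
      refine h.connected (a + s • w) w fun i j hij => ?_
      have h2 := (Finset.sum_eq_zero_iff_of_nonneg fun i _ =>
        Finset.sum_nonneg fun j _ => h0 i j).1 h1.symm i (Finset.mem_univ i)
      have h3 := (Finset.sum_eq_zero_iff_of_nonneg fun j _ => h0 i j).1 h2 j (Finset.mem_univ j)
      rw [mul_assoc] at h3
      have h4 := mul_self_eq_zero.1 ((mul_eq_zero.1 h3).resolve_left hij.ne')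
      linarith
    funext i
    have h5 : (Fintype.card V : ℝ) * w i = 0 := by
      rw [← hw, Finset.sum_congr rfl fun j _ => hconst j i]
      simp
    have : Nonempty V := ⟨i⟩
    exact (mul_eq_zero.1 h5).resolve_left (by positivity)

/-- Constant vectors lie in the kernel of a Laplacian, so `K` is invariant under adding them. -/
theorem curv_add_const (h : IsCurvatureMap K B κ) (u : V → ℝ) (s : ℝ) (i : V) :
    K (u + s • 1) i = K u i := by
  have hline : ∀ s : ℝ, HasDerivAt (fun s : ℝ => K (u + s • 1) i) 0 s := fun s => by
    have h1 : HasDerivAt (fun s : ℝ => u + s • (1 : V → ℝ)) 1 s := by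
      simpa using ((hasDerivAt_id s).smul_const (1 : V → ℝ)).const_add u
    simpa [sum_apply, Function.comp_def] using
      (h.hasFDerivAt (u + s • 1) i).comp_hasDerivAt s h1
  have := is_const_of_deriv_eq_zero (fun s => (hline s).differentiableAt)
    (fun s => (hline s).deriv) s 0
  simpa using this

theorem hasDerivAt_potential_line
    (hG : ∀ u, HasFDerivAt G
      (∑ i, (K u i - κ) • ContinuousLinearMap.proj (R := ℝ) (φ := fun _ : V => ℝ) i) u)
    (a w : V → ℝ) (s : ℝ) :
    HasDerivAt (fun s : ℝ => G (a + s • w)) (∑ i, (K (a + s • w) i - κ) * w i) s := by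
  have h1 : HasDerivAt (fun s : ℝ => a + s • w) w s := by
    simpa using ((hasDerivAt_id s).smul_const w).const_add a
  simpa [sum_apply, Function.comp_def] using (hG (a + s • w)).comp_hasDerivAt s h1

theorem eq_of_curv_eq (h : IsCurvatureMap K B κ) {x : V → ℝ} (ha : ∀ i, K a i = κ)
    (hx : ∀ i, K x i = κ) (hsum : ∑ i, x i = ∑ i, a i) : x = a := by
  by_contra hne
  have := h.strictMono_sum_mul_curv a (w := x - a) (by simp [hsum]) (sub_ne_zero.2 hne) zero_lt_one
  simp [ha, hx] at this

/-- The Ricci potential grows at least linearly away from a point of constant curvature, inside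
the hyperplane of constant sum: by convexity it suffices to bound it below on a sphere, which
is compact. -/
theorem exists_mul_norm_le_potential (h : IsCurvatureMap K B κ)
    (hG : ∀ u, HasFDerivAt G
      (∑ i, (K u i - κ) • ContinuousLinearMap.proj (R := ℝ) (φ := fun _ : V => ℝ) i) u)
    (ha : ∀ i, K a i = κ) {ε : ℝ} (hε : 0 < ε) :
    ∃ m > 0, ∀ x : V → ℝ, ∑ i, x i = ∑ i, a i → ε ≤ ‖x - a‖ → m * ‖x - a‖ ≤ G x - G a := by
  have hGc : Continuous G := continuous_iff_continuousAt.2 fun u => (hG u).continuousAt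
  have hconv : ∀ w : V → ℝ, ∑ i, w i = 0 → w ≠ 0 →
      StrictConvexOn ℝ univ fun s : ℝ => G (a + s • w) := by
    intro w hw hw0
    refine StrictMono.strictConvexOn_univ_of_deriv
      (continuous_iff_continuousAt.2 fun s => (hasDerivAt_potential_line hG a w s).continuousAt) ?_
    rw [show deriv (fun s : ℝ => G (a + s • w))
      = fun s : ℝ => ∑ i, (K (a + s • w) i - κ) * w i from
      funext fun s => (hasDerivAt_potential_line hG a w s).deriv]
    exact h.strictMono_sum_mul_curv a hw hw0
  have hpos : ∀ w : V → ℝ, ∑ i, w i = 0 → w ≠ 0 → 0 < G (a + w) - G a := by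
    intro w hw hw0
    have hmono := h.strictMono_sum_mul_curv a hw hw0
    obtain ⟨c, hc, hc'⟩ := exists_hasDerivAt_eq_slope (fun s : ℝ => G (a + s • w))
      (fun s => ∑ i, (K (a + s • w) i - κ) * w i) zero_lt_one
      (fun s _ => (hasDerivAt_potential_line hG a w s).continuousAt.continuousWithinAt)
      (fun s _ => hasDerivAt_potential_line hG a w s)
    have h0 := hmono hc.1
    simp only [zero_smul, add_zero, ha, sub_self, zero_mul, Finset.sum_const_zero, one_smul,
      sub_zero, div_one] at h0 hc'
    rwa [hc'] at h0
  let S : Set (V → ℝ) := Metric.sphere 0 ε ∩ {w | ∑ i, w i = 0}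
  have hS : IsCompact S := (isCompact_sphere 0 ε).inter_right
    (isClosed_eq (by fun_prop) continuous_const)
  obtain ⟨m, hm, hmS⟩ : ∃ m > 0, ∀ w ∈ S, m ≤ G (a + w) - G a := by
    rcases S.eq_empty_or_nonempty with hE | hne
    · exact ⟨1, one_pos, by simp [hE]⟩
    · obtain ⟨w, hw, hmin⟩ := hS.exists_isMinOn (f := fun w => G (a + w) - G a) hne
        (by fun_prop)
      refine ⟨G (a + w) - G a, hpos w hw.2 ?_, fun y hy => hmin hy⟩
      rintro rfl
      have := hw.1
      simp [hε.ne] at this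
  refine ⟨m / ε, by positivity, fun x hx hxε => ?_⟩
  have hx0 : 0 < ‖x - a‖ := hε.trans_le hxε
  -- the point `a + q (x - a)` lies on the sphere of radius `ε` about `a`
  set q := ε / ‖x - a‖ with hq
  have hq0 : 0 < q := by positivity
  have hq1 : q ≤ 1 := (div_le_one hx0).2 hxε
  have hwsum : ∑ i, (x - a) i = 0 := by simp [hx]
  have h1 := hmS (q • (x - a)) ⟨by
    rw [mem_sphere_zero_iff_norm, norm_smul, Real.norm_of_nonneg hq0.le, hq]
    field_simp, by
    simp only [mem_ofPred_eq, Pi.smul_apply, smul_eq_mul, ← Finset.mul_sum, hwsum, mul_zero]⟩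
  have h2 := (hconv (x - a) hwsum (norm_pos_iff.1 hx0)).convexOn.2 (mem_univ 0) (mem_univ 1)
    (sub_nonneg.2 hq1) hq0.le (by ring)
  simp only [smul_eq_mul, mul_zero, mul_one, zero_add, zero_smul, add_zero, one_smul,
    add_sub_cancel] at h2
  have h3 : m ≤ q * (G x - G a) := by linarith
  have h4 : m / q ≤ G x - G a := (div_le_iff₀' hq0).2 h3
  convert h4 using 1
  rw [hq]
  field_simp

/-! ### Long time behaviour of the flow -/

section Flow

variable {p : ℝ} {u : ℝ → V → ℝ}

theorem sum_eq_of_flow (h : IsCurvatureMap K B κ)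
    (hu : ∀ t ∈ Ici (0 : ℝ), HasDerivWithinAt u (calabiField K B p (u t)) (Ici 0) t)
    {t : ℝ} (ht : 0 ≤ t) : ∑ i, u t i = ∑ i, u 0 i := by
  have h1 : ∀ s ∈ Ici (0 : ℝ), HasDerivWithinAt (fun s => ∑ i, u s i) 0 (Ici 0) s := by
    intro s hs
    have h2 := HasDerivWithinAt.fun_sum (u := Finset.univ)
      fun i _ => hasDerivWithinAt_pi.1 (hu s hs) i
    rwa [h.sum_calabiField p (u s)] at h2
  have h2 := (convex_Ici (0 : ℝ)).norm_image_sub_le_of_norm_hasDerivWithin_le (C := 0) h1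
    (fun _ _ => by simp) (mem_Ici.2 le_rfl) (mem_Ici.2 ht)
  simpa [sub_eq_zero] using h2

/-- The Ricci potential is a Lyapunov function: where the curvature is not constant it decreases
at a positive rate. -/
theorem tendsto_of_flow (h : IsCurvatureMap K B κ) (hp : 1 < p) (ha : ∀ i, K a i = κ)
    (hu : ∀ t ∈ Ici (0 : ℝ), HasDerivWithinAt u (calabiField K B p (u t)) (Ici 0) t)
    (hsum : ∑ i, u 0 i = ∑ i, a i) : Tendsto u atTop (𝓝 a) := by
  obtain ⟨G, hG⟩ := h.exists_potential
  have hGc : Continuous G := continuous_iff_continuousAt.2 fun u => (hG u).continuousAt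
  have hsum' : ∀ t, 0 ≤ t → ∑ i, u t i = ∑ i, a i := fun t ht => (h.sum_eq_of_flow hu ht).trans hsum
  have hder : ∀ t ∈ Ici (0 : ℝ),
      HasDerivWithinAt (fun t => G (u t)) (-dissipation K B p (u t)) (Ici 0) t := by
    intro t ht
    have h1 := (hG (u t)).comp_hasDerivWithinAt t (hu t ht)
    rw [← h.sum_curv_mul_calabiField]
    simpa [sum_apply, Function.comp_def] using h1
  have hcont : ContinuousOn (fun t => G (u t)) (Ici 0) := fun t ht =>
    (hder t ht).continuousWithinAt
  have hanti : AntitoneOn (fun t => G (u t)) (Ici 0) :=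
    antitoneOn_of_hasDerivWithinAt_nonpos (convex_Ici 0) hcont
      (fun t ht => (hder t (interior_subset ht)).mono interior_subset)
      fun t _ => neg_nonpos.2 (h.dissipation_nonneg p _)
  obtain ⟨m₁, hm₁, hm₁'⟩ := h.exists_mul_norm_le_potential hG ha one_pos
  set R := max 1 ((G (u 0) - G a) / m₁)
  have hR : ∀ t, 0 ≤ t → ‖u t - a‖ ≤ R := by
    intro t ht
    rcases le_total ‖u t - a‖ 1 with h1 | h1
    · exact h1.trans (le_max_left _ _)
    · refine le_trans ((le_div_iff₀' hm₁).2 ?_) (le_max_right _ _)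
      have h2 : G (u t) ≤ G (u 0) := hanti (mem_Ici.2 le_rfl) (mem_Ici.2 ht) ht
      linarith [hm₁' (u t) (hsum' t ht) h1]
  rw [Metric.tendsto_atTop]
  -- if `u` is infinitely often at distance `ε` from `a`, then the decreasing quantity `G (u t)`
  -- stays away from its minimum `G a`, and it decreases at a rate bounded below
  by_contra! hcon
  obtain ⟨ε, hε, hfreq⟩ := hcon
  obtain ⟨m, hm, hm'⟩ := h.exists_mul_norm_le_potential hG ha hε
  have hlow : ∀ t, 0 ≤ t → m * ε ≤ G (u t) - G a := by
    intro t ht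
    obtain ⟨s, hts, hs⟩ := hfreq t
    rw [dist_eq_norm] at hs
    have h1 : G (u s) ≤ G (u t) := hanti (mem_Ici.2 ht) (mem_Ici.2 (ht.trans hts)) hts
    have h2 := hm' (u s) (hsum' s (ht.trans hts)) hs
    have h3 := mul_le_mul_of_nonneg_left hs hm.le
    linarith
  let C : Set (V → ℝ) :=
    Metric.closedBall a R ∩ ({x | ∑ i, x i = ∑ i, a i} ∩ {x | m * ε ≤ G x - G a})
  have hC : IsCompact C := (isCompact_closedBall a R).inter_right
    ((isClosed_eq (by fun_prop) continuous_const).inter (isClosed_le continuous_const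
      (by fun_prop)))
  have huC : ∀ t, 0 ≤ t → u t ∈ C := fun t ht =>
    ⟨mem_closedBall_iff_norm.2 (hR t ht), hsum' t ht, hlow t ht⟩
  obtain ⟨y, hy, hmin⟩ := hC.exists_isMinOn ⟨u 0, huC 0 le_rfl⟩
    (h.continuous_dissipation hp).continuousOn
  set d := dissipation K B p y
  have hd : 0 < d := by
    refine lt_of_le_of_ne (h.dissipation_nonneg p y) fun h0 => ?_
    have hya : y = a :=
      h.eq_of_curv_eq ha (h.curv_eq_of_dissipation_eq_zero h0.symm) hy.2.1
    have h1 : m * ε ≤ G y - G a := hy.2.2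
    rw [hya, sub_self] at h1
    exact absurd h1 (not_le.2 (mul_pos hm hε))
  have hanti' : AntitoneOn (fun t => G (u t) + t * d) (Ici 0) := by
    refine antitoneOn_of_hasDerivWithinAt_nonpos
      (f' := fun t => -dissipation K B p (u t) + 1 * d) (convex_Ici 0)
      (hcont.add (by fun_prop)) (fun t ht => ?_) fun t ht => ?_
    · exact ((hder t (interior_subset ht)).mono interior_subset).add
        ((hasDerivWithinAt_id t _).mul_const d)
    · have h1 : d ≤ dissipation K B p (u t) := hmin (huC t (interior_subset ht))
      linarith
  have hG0 : 0 ≤ G (u 0) - G a := (mul_pos hm hε).le.trans (hlow 0 le_rfl)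
  set t := (G (u 0) - G a) / d
  have ht : 0 ≤ t := div_nonneg hG0 hd.le
  have h1 : G (u t) + t * d ≤ G (u 0) + 0 * d := hanti' (mem_Ici.2 le_rfl) (mem_Ici.2 ht) ht
  rw [div_mul_cancel₀ _ hd.ne'] at h1
  have h2 := hlow t ht
  have h3 := mul_pos hm hε
  linarith

theorem curv_eq_of_flow_tendsto (h : IsCurvatureMap K B κ) (hp : 1 < p)
    (hu : ∀ t ∈ Ici (0 : ℝ), HasDerivWithinAt u (calabiField K B p (u t)) (Ici 0) t)
    {b : V → ℝ} (hb : Tendsto u atTop (𝓝 b)) (i : V) : K b i = κ := by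
  refine h.curv_eq_of_calabiField_eq_zero (p := p) (funext fun i => ?_) i
  have h1 : Tendsto (fun t => calabiField K B p (u t)) atTop (𝓝 (calabiField K B p b)) :=
    ((h.continuous_calabiField hp).tendsto b).comp hb
  refine eq_zero_of_tendsto_of_tendsto_deriv (f := fun t => u t i) (fun t ht => ?_)
    (tendsto_pi_nhds.1 hb i) (tendsto_pi_nhds.1 h1 i)
  exact (hasDerivWithinAt_pi.1 (hu t ht.le) i).hasDerivAt (Ici_mem_nhds ht)

end Flow

end IsCurvatureMap

/-! ### The law of cosines -/

section LawOfCosines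

/-- Sixteen times the square of the area of a triangle in terms of the squares of its sides. -/
def heron (a b c : ℝ) : ℝ := 2 * a * b + 2 * b * c + 2 * c * a - a ^ 2 - b ^ 2 - c ^ 2

/-- The cosine of the angle opposite to the side `√a` in a triangle with sides `√a`, `√b`, `√c`. -/
noncomputable def cosAngle (a b c : ℝ) : ℝ := (√b ^ 2 + √c ^ 2 - √a ^ 2) / (2 * √b * √c)

variable {a b c : ℝ}

theorem sqrt_one_sub_cosAngle_sq (ha : 0 < a) (hb : 0 < b) (hc : 0 < c) :
    √(1 - cosAngle a b c ^ 2) = √(heron a b c) / (2 * √b * √c) := by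
  have hb' := Real.sqrt_pos.2 hb
  have hc' := Real.sqrt_pos.2 hc
  have h : 1 - cosAngle a b c ^ 2 = heron a b c / (2 * √b * √c) ^ 2 := by
    have e : (2 * √b * √c) ^ 2 = 4 * b * c := by
      rw [mul_pow, mul_pow, Real.sq_sqrt hb.le, Real.sq_sqrt hc.le]
      ring
    rw [cosAngle, div_pow, e, Real.sq_sqrt ha.le, Real.sq_sqrt hb.le, Real.sq_sqrt hc.le, heron]
    field_simp
    ring
  rw [h, Real.sqrt_div' _ (by positivity), Real.sqrt_sq (by positivity)]

theorem abs_cosAngle_lt_one (ha : 0 < a) (hb : 0 < b) (hc : 0 < c) (h : 0 < heron a b c) :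
    |cosAngle a b c| < 1 := by
  have hb' := Real.sqrt_pos.2 hb
  have hc' := Real.sqrt_pos.2 hc
  have h1 : 0 < √(1 - cosAngle a b c ^ 2) := by
    rw [sqrt_one_sub_cosAngle_sq ha hb hc]
    have := Real.sqrt_pos.2 h
    positivity
  rw [← sq_lt_one_iff_abs_lt_one]
  linarith [Real.sqrt_pos.1 h1]

theorem cos_arccos_cosAngle (ha : 0 < a) (hb : 0 < b) (hc : 0 < c) (h : 0 < heron a b c) :
    Real.cos (Real.arccos (cosAngle a b c)) = cosAngle a b c :=
  have h1 := abs_lt.1 (abs_cosAngle_lt_one ha hb hc h)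
  Real.cos_arccos h1.1.le h1.2.le

theorem sin_arccos_cosAngle (ha : 0 < a) (hb : 0 < b) (hc : 0 < c) :
    Real.sin (Real.arccos (cosAngle a b c)) = √(heron a b c) / (2 * √b * √c) := by
  rw [Real.sin_arccos, sqrt_one_sub_cosAngle_sq ha hb hc]

/-- The angle sum of a Euclidean triangle, in terms of the law of cosines. -/
theorem arccos_cosAngle_add_add (ha : 0 < a) (hb : 0 < b) (hc : 0 < c) (h : 0 < heron a b c) :
    Real.arccos (cosAngle a b c) + Real.arccos (cosAngle b c a) + Real.arccos (cosAngle c a b)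
      = Real.pi := by
  have ha' := Real.sqrt_pos.2 ha
  have hb' := Real.sqrt_pos.2 hb
  have hc' := Real.sqrt_pos.2 hc
  have h2 : heron b c a = heron a b c := by unfold heron; ring
  have h3 : heron c a b = heron a b c := by unfold heron; ring
  have hS := Real.sqrt_pos.2 h
  have hS2 := Real.sq_sqrt h.le
  have sa := Real.sq_sqrt ha.le
  have sb := Real.sq_sqrt hb.le
  have sc := Real.sq_sqrt hc.le
  set x := Real.arccos (cosAngle a b c)
  set y := Real.arccos (cosAngle b c a)
  set z := Real.arccos (cosAngle c a b)
  have hx := cos_arccos_cosAngle ha hb hc h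
  have hy := cos_arccos_cosAngle hb hc ha (h2 ▸ h)
  have hz := cos_arccos_cosAngle hc ha hb (h3 ▸ h)
  have hx' := sin_arccos_cosAngle ha hb hc
  have hy' := sin_arccos_cosAngle hb hc ha
  rw [h2] at hy'
  -- `cos` determines `x + y` once `sin (x + y) > 0` places it in `[0, π]`
  have hcos : Real.cos (x + y) = Real.cos (Real.pi - z) := by
    rw [Real.cos_add, Real.cos_pi_sub, hx, hy, hz, hx', hy']
    unfold cosAngle
    rw [div_mul_div_comm, div_mul_div_comm, ← pow_two √(heron a b c), hS2, heron]
    field_simp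
    rw [sa, sb, sc]
    ring
  have hsin : 0 < Real.sin (x + y) := by
    have e : Real.sin (x + y) = √(heron a b c) / (2 * √a * √b) := by
      rw [Real.sin_add, hx, hy, hx', hy']
      unfold cosAngle
      field_simp
      rw [sa, sb, sc]
      ring
    rw [e]
    positivity
  have hle : x + y ≤ Real.pi := by
    by_contra! hlt
    have h4 : Real.sin (x + y - Real.pi) = -Real.sin (x + y) := Real.sin_sub_pi _
    have h5 : 0 ≤ Real.sin (x + y - Real.pi) :=
      Real.sin_nonneg_of_nonneg_of_le_pi (by linarith)
        (by linarith [Real.arccos_le_pi (cosAngle a b c), Real.arccos_le_pi (cosAngle b c a)])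
    linarith
  have := Real.injOn_cos
    ⟨add_nonneg (Real.arccos_nonneg _) (Real.arccos_nonneg _), hle⟩
    ⟨by linarith [Real.arccos_le_pi (cosAngle c a b)],
      by linarith [Real.arccos_nonneg (cosAngle c a b)]⟩ hcos
  linarith

/-- The derivative of an angle as a function of the squared lengths of the sides. -/
theorem hasFDerivAt_arccos_cosAngle {E : Type*} [NormedAddCommGroup E] [NormedSpace ℝ E]
    {f g h : E → ℝ} {f' g' h' : E →L[ℝ] ℝ} {q : E} (hf : HasFDerivAt f f' q)
    (hg : HasFDerivAt g g' q) (hh : HasFDerivAt h h' q) (ha : 0 < f q) (hb : 0 < g q)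
    (hc : 0 < h q) (hpos : 0 < heron (f q) (g q) (h q)) :
    HasFDerivAt (fun y => Real.arccos (cosAngle (f y) (g y) (h y)))
      ((√(heron (f q) (g q) (h q)))⁻¹ • (f' - ((f q + g q - h q) / (2 * g q)) • g'
        - ((f q + h q - g q) / (2 * h q)) • h')) q := by
  have hb' := Real.sqrt_pos.2 hb
  have hc' := Real.sqrt_pos.2 hc
  have sb := Real.sq_sqrt hb.le
  have sc := Real.sq_sqrt hc.le
  have hS := Real.sqrt_pos.2 hpos
  have h1 := abs_lt.1 (abs_cosAngle_lt_one ha hb hc hpos)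
  have hnum := (((hg.sqrt hb.ne').pow 2).add ((hh.sqrt hc.ne').pow 2)).sub
    ((hf.sqrt ha.ne').pow 2)
  have hden := ((hg.sqrt hb.ne').const_mul 2).mul (hh.sqrt hc.ne')
  have hinv := (hasDerivAt_inv (x := 2 * √(g q) * √(h q)) (by positivity)).comp_hasFDerivAt q hden
  have hquot := hnum.mul hinv
  have harc := (Real.hasDerivAt_arccos h1.1.ne' h1.2.ne).comp_hasFDerivAt q hquot
  rw [sqrt_one_sub_cosAngle_sq ha hb hc] at harc
  refine harc.congr_fderiv ?_
  have sa := Real.sq_sqrt ha.le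
  have ha' := Real.sqrt_pos.2 ha
  ext w
  simp only [smul_apply, add_apply,
    sub_apply, smul_eq_mul, Pi.add_apply, Pi.sub_apply,
    Pi.mul_apply, Function.comp_apply]
  generalize √(heron (f q) (g q) (h q)) = S at *
  generalize √(f q) = A at *
  generalize √(g q) = B at *
  generalize √(h q) = C at *
  rw [← sa, ← sb, ← sc]
  field_simp
  ring

end LawOfCosines

/-! ### A triangle of three circles -/

section Triangle

/-- The square of the length of the edge opposite to the corner `c`, for the radii `x` and the
cosines `w` of the weights, where `w c` belongs to the edge opposite to `c`. -/
def sqLength (w x : Fin 3 → ℝ) (c : Fin 3) : ℝ :=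
  x (c + 1) ^ 2 + x (c + 2) ^ 2 + 2 * x (c + 1) * x (c + 2) * w c

/-- The contribution of the edge opposite to the corner `c` to the squared area. Four times the
sum of these three terms is `heron` of the squared lengths. -/
def edgeTerm (w x : Fin 3 → ℝ) (c : Fin 3) : ℝ :=
  x (c + 1) * x (c + 2) * (x (c + 1) * x (c + 2) * (1 - w c ^ 2)
    + x (c + 1) * x c * (w (c + 1) + w (c + 2) * w c)
    + x (c + 2) * x c * (w (c + 2) + w (c + 1) * w c))

/-- Four times the area of the triangle. -/
noncomputable def fourArea (w x : Fin 3 → ℝ) : ℝ := √(4 * ∑ c, edgeTerm w x c)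

/-- The derivative of the angle at one end of the edge opposite to `c` with respect to the logarithm
of the radius at the other end. It is symmetric in the two ends. -/
noncomputable def conductance (w x : Fin 3 → ℝ) (c : Fin 3) : ℝ :=
  2 * edgeTerm w x c / (fourArea w x * sqLength w x c)

theorem fin_three_add_one_add_one (c : Fin 3) : c + 1 + 1 = c + 2 := by omega

theorem fin_three_add_one_add_two (c : Fin 3) : c + 1 + 2 = c := by omega

theorem fin_three_add_two_add_one (c : Fin 3) : c + 2 + 1 = c := by omega

theorem fin_three_add_two_add_two (c : Fin 3) : c + 2 + 2 = c + 1 := by omega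

theorem sum_fin_three (f : Fin 3 → ℝ) (c : Fin 3) : ∑ d, f d = f c + f (c + 1) + f (c + 2) := by
  rw [Fin.sum_univ_three]
  fin_cases c
  · rfl
  · change f 0 + f 1 + f 2 = f 1 + f 2 + f 0
    ring
  · change f 0 + f 1 + f 2 = f 2 + f 0 + f 1
    ring

theorem heron_sqLength (w x : Fin 3 → ℝ) (c : Fin 3) :
    heron (sqLength w x c) (sqLength w x (c + 1)) (sqLength w x (c + 2))
      = 4 * ∑ d, edgeTerm w x d := by
  rw [sum_fin_three _ c]
  simp only [heron, sqLength, edgeTerm, fin_three_add_one_add_one, fin_three_add_one_add_two,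
    fin_three_add_two_add_one, fin_three_add_two_add_two]
  ring

variable {w x : Fin 3 → ℝ}

theorem add_sq_le_sqLength (hw : ∀ c, w c ∈ Icc (0 : ℝ) 1) (hx : ∀ c, 0 < x c) (c : Fin 3) :
    x (c + 1) ^ 2 + x (c + 2) ^ 2 ≤ sqLength w x c := by
  have := mul_nonneg (mul_pos (hx (c + 1)) (hx (c + 2))).le (hw c).1
  unfold sqLength
  linarith

theorem sqLength_pos (hw : ∀ c, w c ∈ Icc (0 : ℝ) 1) (hx : ∀ c, 0 < x c) (c : Fin 3) :
    0 < sqLength w x c := by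
  have h1 := hx (c + 1)
  have h2 := hx (c + 2)
  exact lt_of_lt_of_le (by positivity) (add_sq_le_sqLength hw hx c)

theorem edgeTerm_nonneg (hw : ∀ c, w c ∈ Icc (0 : ℝ) 1) (hx : ∀ c, 0 < x c) (c : Fin 3) :
    0 ≤ edgeTerm w x c := by
  have h0 := hx c
  have h1 := hx (c + 1)
  have h2 := hx (c + 2)
  have w0 := (hw c).1
  have w1 := (hw (c + 1)).1
  have w2 := (hw (c + 2)).1
  have : 0 ≤ 1 - w c ^ 2 := by nlinarith [(hw c).2]
  unfold edgeTerm
  positivity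

/-- The term of an edge vanishes only if its two circles are tangent and both are orthogonal to the
third circle, which can happen for at most one edge of a triangle. -/
theorem eq_of_edgeTerm_eq_zero (hw : ∀ c, w c ∈ Icc (0 : ℝ) 1) (hx : ∀ c, 0 < x c) {c : Fin 3}
    (h : edgeTerm w x c = 0) : w c = 1 ∧ w (c + 1) = 0 ∧ w (c + 2) = 0 := by
  have h0 := hx c
  have h1 := hx (c + 1)
  have h2 := hx (c + 2)
  have w0 := (hw c).1
  have w1 := (hw (c + 1)).1
  have w2 := (hw (c + 2)).1
  have w3 : 0 ≤ 1 - w c ^ 2 := by nlinarith [(hw c).2]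
  have e := (mul_eq_zero.1 h).resolve_left (by positivity)
  have p1 : 0 ≤ x (c + 1) * x (c + 2) * (1 - w c ^ 2) := by positivity
  have p2 : 0 ≤ x (c + 1) * x c * (w (c + 1) + w (c + 2) * w c) := by positivity
  have p3 : 0 ≤ x (c + 2) * x c * (w (c + 2) + w (c + 1) * w c) := by positivity
  have q1 := (mul_eq_zero.1 (by linarith : x (c + 1) * x (c + 2) * (1 - w c ^ 2) = 0)).resolve_left
    (by positivity)
  have q2 := (mul_eq_zero.1 (by linarith :
    x (c + 1) * x c * (w (c + 1) + w (c + 2) * w c) = 0)).resolve_left (by positivity)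
  have q3 := (mul_eq_zero.1 (by linarith :
    x (c + 2) * x c * (w (c + 2) + w (c + 1) * w c) = 0)).resolve_left (by positivity)
  have r1 := mul_nonneg w2 w0
  have r2 := mul_nonneg w1 w0
  exact ⟨by nlinarith, by linarith, by linarith⟩

theorem edgeTerm_pos_of_edgeTerm_eq_zero (hw : ∀ c, w c ∈ Icc (0 : ℝ) 1) (hx : ∀ c, 0 < x c)
    {c d : Fin 3} (h : edgeTerm w x c = 0) (hd : d ≠ c) : 0 < edgeTerm w x d := by
  refine lt_of_le_of_ne (edgeTerm_nonneg hw hx d) fun h0 => ?_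
  obtain ⟨-, h1, h2⟩ := eq_of_edgeTerm_eq_zero hw hx h
  have h3 := (eq_of_edgeTerm_eq_zero hw hx h0.symm).1
  obtain rfl | rfl : d = c + 1 ∨ d = c + 2 := by omega
  · exact zero_ne_one (h1.symm.trans h3)
  · exact zero_ne_one (h2.symm.trans h3)

theorem sum_edgeTerm_pos (hw : ∀ c, w c ∈ Icc (0 : ℝ) 1) (hx : ∀ c, 0 < x c) :
    0 < ∑ c, edgeTerm w x c := by
  rw [sum_fin_three _ 0]
  have h0 := edgeTerm_nonneg hw hx 0
  have h1 := edgeTerm_nonneg hw hx (0 + 1)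
  have h2 := edgeTerm_nonneg hw hx (0 + 2)
  rcases h0.eq_or_lt with h | h
  · have := edgeTerm_pos_of_edgeTerm_eq_zero hw hx h.symm (d := 0 + 1) (by decide)
    linarith
  · linarith

theorem heron_sqLength_pos (hw : ∀ c, w c ∈ Icc (0 : ℝ) 1) (hx : ∀ c, 0 < x c) (c : Fin 3) :
    0 < heron (sqLength w x c) (sqLength w x (c + 1)) (sqLength w x (c + 2)) := by
  rw [heron_sqLength]
  have := sum_edgeTerm_pos hw hx
  positivity

theorem fourArea_pos (hw : ∀ c, w c ∈ Icc (0 : ℝ) 1) (hx : ∀ c, 0 < x c) : 0 < fourArea w x :=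
  Real.sqrt_pos.2 (mul_pos four_pos (sum_edgeTerm_pos hw hx))

theorem conductance_nonneg (hw : ∀ c, w c ∈ Icc (0 : ℝ) 1) (hx : ∀ c, 0 < x c) (c : Fin 3) :
    0 ≤ conductance w x c :=
  div_nonneg (mul_nonneg two_pos.le (edgeTerm_nonneg hw hx c))
    (mul_pos (fourArea_pos hw hx) (sqLength_pos hw hx c)).le

theorem conductance_pos (hw : ∀ c, w c ∈ Icc (0 : ℝ) 1) (hx : ∀ c, 0 < x c) {c : Fin 3}
    (h : 0 < edgeTerm w x c) : 0 < conductance w x c :=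
  div_pos (mul_pos two_pos h) (mul_pos (fourArea_pos hw hx) (sqLength_pos hw hx c))

/-- At least two of the three edges of a triangle have positive conductance. -/
theorem eq_of_forall_conductance_pos (hw : ∀ c, w c ∈ Icc (0 : ℝ) 1) (hx : ∀ c, 0 < x c)
    {g : Fin 3 → ℝ} (hg : ∀ c, 0 < conductance w x c → g (c + 1) = g (c + 2)) (a b : Fin 3) :
    g a = g b := by
  have key : ∀ c, g (c + 1) = g (c + 2) := by
    intro c
    rcases (edgeTerm_nonneg hw hx c).eq_or_lt with h | h
    · have h1 := hg _ (conductance_pos hw hx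
        (edgeTerm_pos_of_edgeTerm_eq_zero hw hx h.symm (d := c + 1) (by omega)))
      have h2 := hg _ (conductance_pos hw hx
        (edgeTerm_pos_of_edgeTerm_eq_zero hw hx h.symm (d := c + 2) (by omega)))
      rw [fin_three_add_one_add_one, fin_three_add_one_add_two] at h1
      rw [fin_three_add_two_add_one, fin_three_add_two_add_two] at h2
      exact (h1.trans h2).symm
    · exact hg c (conductance_pos hw hx h)
  have h0 : g 1 = g 2 := key 0
  have h1 : g 2 = g 0 := key 1
  fin_cases a <;> fin_cases b <;> simp [h0, h1]

/-- The mixed terms of `edgeTerm` are controlled by the area. If the weight of the second edge has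
cosine at most `1/2`, the area is at least of the order of `x z`; otherwise it is at least of the
order of `z √(x y)` times the coefficient. -/
theorem mixedTerm_le {x y z α β γ S : ℝ} (hx : 0 < x) (hy : 0 < y) (hz : 0 < z)
    (hα : α ∈ Icc (0 : ℝ) 1) (hβ : β ∈ Icc (0 : ℝ) 1) (hγ : γ ∈ Icc (0 : ℝ) 1) (hS : 0 ≤ S)
    (h : 4 * (x * z) ^ 2 * (1 - β ^ 2) + 8 * x * y * z ^ 2 * (γ + α * β) ≤ S ^ 2) :
    x ^ 2 * y * z * (α + β * γ) ≤ 2 * (S * (x ^ 2 + y ^ 2)) := by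
  obtain ⟨α0, α1⟩ := hα
  obtain ⟨β0, β1⟩ := hβ
  obtain ⟨γ0, γ1⟩ := hγ
  have hβγ0 : 0 ≤ β * γ := mul_nonneg β0 γ0
  have hβγ1 : β * γ ≤ γ := mul_le_of_le_one_left γ0 β1
  have hA0 : 0 ≤ α + β * γ := by linarith
  have hA2 : α + β * γ ≤ 2 := by linarith
  have hβ2 : 0 ≤ 1 - β ^ 2 := by nlinarith
  refine abs_le_of_sq_le_sq' ?_ (by positivity) |>.2
  have hxy : x * y ≤ x ^ 2 + y ^ 2 := by nlinarith [sq_nonneg (x - y), mul_pos hx hy]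
  have hxy2 : (x * y) ^ 2 ≤ (x ^ 2 + y ^ 2) ^ 2 := pow_le_pow_left₀ (by positivity) hxy 2
  rcases le_total β (1 / 2) with hb | hb
  · have h1 : 3 * (x * z) ^ 2 ≤ S ^ 2 := by
      have h2 : 0 ≤ 8 * x * y * z ^ 2 * (γ + α * β) := by positivity
      have h3 : 3 / 4 ≤ 1 - β ^ 2 := by nlinarith
      have h4 := mul_le_mul_of_nonneg_left h3 (by positivity : 0 ≤ 4 * (x * z) ^ 2)
      linarith
    calc (x ^ 2 * y * z * (α + β * γ)) ^ 2 = (x * z) ^ 2 * (x * y) ^ 2 * (α + β * γ) ^ 2 := by ring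
      _ ≤ S ^ 2 * (x ^ 2 + y ^ 2) ^ 2 * 2 ^ 2 := by
        have h2 : (x * z) ^ 2 ≤ S ^ 2 := by linarith [sq_nonneg (x * z)]
        gcongr
      _ = (2 * (S * (x ^ 2 + y ^ 2))) ^ 2 := by ring
  · have h1 : 4 * x * y * z ^ 2 * (α + β * γ) ≤ S ^ 2 := by
      have h2 : 0 ≤ 4 * (x * z) ^ 2 * (1 - β ^ 2) := by positivity
      have h3 : α * (1 / 2) ≤ α * β := mul_le_mul_of_nonneg_left hb α0
      have h4 : α + β * γ ≤ 2 * (γ + α * β) := by linarith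
      have h5 := mul_le_mul_of_nonneg_left h4 (by positivity : 0 ≤ 4 * x * y * z ^ 2)
      linarith
    have hx2 : x ^ 2 ≤ x ^ 2 + y ^ 2 := by linarith [sq_nonneg y]
    calc (x ^ 2 * y * z * (α + β * γ)) ^ 2
        = 1 / 4 * (4 * x * y * z ^ 2 * (α + β * γ)) * (x ^ 2 * (x * y)) * (α + β * γ) := by ring
      _ ≤ 1 / 4 * S ^ 2 * ((x ^ 2 + y ^ 2) * (x ^ 2 + y ^ 2)) * 2 := by gcongr
      _ ≤ (2 * (S * (x ^ 2 + y ^ 2))) ^ 2 := by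
        have : 0 ≤ S ^ 2 * (x ^ 2 + y ^ 2) ^ 2 := by positivity
        linarith

/-- The conductances are bounded, uniformly in the radii. -/
theorem conductance_le (hw : ∀ c, w c ∈ Icc (0 : ℝ) 1) (hx : ∀ c, 0 < x c) (c : Fin 3) :
    conductance w x c ≤ 10 := by
  have h0 := hx c
  have h1 := hx (c + 1)
  have h2 := hx (c + 2)
  have S0 := fourArea_pos hw hx
  have hS2 : fourArea w x ^ 2
      = 4 * (edgeTerm w x c + edgeTerm w x (c + 1) + edgeTerm w x (c + 2)) := by
    rw [fourArea, Real.sq_sqrt (mul_pos four_pos (sum_edgeTerm_pos hw hx)).le, sum_fin_three _ c]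
  have hL := add_sq_le_sqLength hw hx c
  rw [conductance, div_le_iff₀ (mul_pos S0 (sqLength_pos hw hx c))]
  have hmul := mul_le_mul_of_nonneg_left hL S0.le
  suffices 2 * edgeTerm w x c ≤ 10 * (fourArea w x * (x (c + 1) ^ 2 + x (c + 2) ^ 2)) by linarith
  simp only [edgeTerm, fin_three_add_one_add_one, fin_three_add_one_add_two,
    fin_three_add_two_add_one, fin_three_add_two_add_two] at hS2 ⊢
  have hα := hw (c + 1)
  have hβ := hw (c + 2)
  have hγ := hw c
  generalize fourArea w x = S at *
  generalize x c = z at *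
  generalize x (c + 2) = y at *
  generalize x (c + 1) = x at *
  generalize w c = γ at *
  generalize w (c + 1) = α at *
  generalize w (c + 2) = β at *
  have α0 := hα.1
  have β0 := hβ.1
  have γ0 := hγ.1
  have hα2 : 0 ≤ 1 - α ^ 2 := by nlinarith [hα.2]
  have hβ2 : 0 ≤ 1 - β ^ 2 := by nlinarith [hβ.2]
  have hγ2 : 0 ≤ 1 - γ ^ 2 := by nlinarith [hγ.2]
  have p1 : 0 ≤ (x * y) ^ 2 * (1 - γ ^ 2) := by positivity
  have p2 : 0 ≤ (x * z) ^ 2 * (1 - β ^ 2) := by positivity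
  have p3 : 0 ≤ (y * z) ^ 2 * (1 - α ^ 2) := by positivity
  have p4 : 0 ≤ x ^ 2 * y * z * (α + β * γ) := by positivity
  have p5 : 0 ≤ x * y ^ 2 * z * (β + α * γ) := by positivity
  have p6 : 0 ≤ x * y * z ^ 2 * (γ + α * β) := by positivity
  have e1 := mixedTerm_le h1 h2 h0 hα hβ hγ S0.le (by linarith)
  have e2 := mixedTerm_le h2 h1 h0 hβ hα hγ S0.le (by linarith)
  have e3 : (x * y) ^ 2 * (1 - γ ^ 2) ≤ S * (x ^ 2 + y ^ 2) := by
    refine abs_le_of_sq_le_sq' ?_ (by positivity) |>.2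
    have hxy : x * y ≤ x ^ 2 + y ^ 2 := by nlinarith [sq_nonneg (x - y), mul_pos h1 h2]
    have hle : 1 - γ ^ 2 ≤ 1 := by linarith [sq_nonneg γ]
    calc ((x * y) ^ 2 * (1 - γ ^ 2)) ^ 2
        = ((x * y) ^ 2 * (1 - γ ^ 2)) * (x * y) ^ 2 * (1 - γ ^ 2) := by ring
      _ ≤ S ^ 2 * (x ^ 2 + y ^ 2) ^ 2 * 1 := by
        have : (x * y) ^ 2 * (1 - γ ^ 2) ≤ S ^ 2 := by linarith
        gcongr
      _ = (S * (x ^ 2 + y ^ 2)) ^ 2 := by ring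
  linarith

/-- The derivative of an angle of the triangle with respect to the radii. -/
theorem hasFDerivAt_angle_of_radii {E : Type*} [NormedAddCommGroup E] [NormedSpace ℝ E]
    {w : Fin 3 → ℝ} {X : E → Fin 3 → ℝ} {X' : Fin 3 → E →L[ℝ] ℝ} {q : E}
    (hX : ∀ c, HasFDerivAt (fun y => X y c) (X' c) q) (hw : ∀ c, w c ∈ Icc (0 : ℝ) 1)
    (hx : ∀ c, 0 < X q c) (c : Fin 3) :
    HasFDerivAt (fun y => Real.arccos (cosAngle (sqLength w (X y) c) (sqLength w (X y) (c + 1))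
        (sqLength w (X y) (c + 2))))
      (conductance w (X q) (c + 2) • ((X q (c + 1))⁻¹ • X' (c + 1) - (X q c)⁻¹ • X' c)
        + conductance w (X q) (c + 1) • ((X q (c + 2))⁻¹ • X' (c + 2) - (X q c)⁻¹ • X' c)) q := by
  have hL : ∀ c, HasFDerivAt (fun y => sqLength w (X y) c)
      (2 • (X q (c + 1) • X' (c + 1) + X q (c + 2) • X' (c + 2)
        + w c • (X q (c + 1) • X' (c + 2) + X q (c + 2) • X' (c + 1)))) q := by
    intro c
    have h := (((hX (c + 1)).pow 2).add ((hX (c + 2)).pow 2)).add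
      ((((hX (c + 1)).const_mul 2).mul (hX (c + 2))).mul_const (w c))
    refine h.congr_fderiv ?_
    ext y
    simp only [smul_apply, add_apply, smul_eq_mul, nsmul_eq_mul]
    push_cast
    ring
  have h := hasFDerivAt_arccos_cosAngle (hL c) (hL (c + 1)) (hL (c + 2)) (sqLength_pos hw hx _)
    (sqLength_pos hw hx _) (sqLength_pos hw hx _) (heron_sqLength_pos hw hx c)
  refine h.congr_fderiv ?_
  have S0 := fourArea_pos hw hx
  rw [heron_sqLength, ← fourArea]
  have l1 := sqLength_pos hw hx (c + 1)
  have l2 := sqLength_pos hw hx (c + 2)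
  have h0 := hx c
  have h1 := hx (c + 1)
  have h2 := hx (c + 2)
  ext y
  simp only [conductance, smul_apply, add_apply, sub_apply, smul_eq_mul,
    nsmul_eq_mul]
  have e0 : sqLength w (X q) c = X q (c + 1) ^ 2 + X q (c + 2) ^ 2
    + 2 * X q (c + 1) * X q (c + 2) * w c := rfl
  have e1 : sqLength w (X q) (c + 1) = X q (c + 2) ^ 2 + X q c ^ 2
      + 2 * X q (c + 2) * X q c * w (c + 1) := by
    simp only [sqLength, fin_three_add_one_add_one, fin_three_add_one_add_two]
  have e2 : sqLength w (X q) (c + 2) = X q c ^ 2 + X q (c + 1) ^ 2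
      + 2 * X q c * X q (c + 1) * w (c + 2) := by
    simp only [sqLength, fin_three_add_two_add_one, fin_three_add_two_add_two]
  clear h hL
  generalize fourArea w (X q) = S at *
  simp only [edgeTerm, fin_three_add_one_add_one, fin_three_add_one_add_two,
    fin_three_add_two_add_one, fin_three_add_two_add_two]
  generalize sqLength w (X q) c = L₀ at *
  generalize sqLength w (X q) (c + 1) = L₁ at *
  generalize sqLength w (X q) (c + 2) = L₂ at *
  generalize X q c = a at *
  generalize X q (c + 1) = b at *
  generalize X q (c + 2) = d at *
  generalize w c = α at *
  generalize w (c + 1) = β at *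
  generalize w (c + 2) = γ at *
  push_cast
  field_simp
  rw [e0, e1, e2]
  ring

theorem continuous_conductance {E : Type*} [TopologicalSpace E] {w : Fin 3 → ℝ}
    {X : E → Fin 3 → ℝ} (hX : ∀ c, Continuous fun y => X y c) (hw : ∀ c, w c ∈ Icc (0 : ℝ) 1)
    (hx : ∀ y c, 0 < X y c) (c : Fin 3) : Continuous fun y => conductance w (X y) c := by
  have h1 : ∀ c, Continuous fun y => edgeTerm w (X y) c := fun c => by
    have := hX c
    have := hX (c + 1)
    have := hX (c + 2)
    unfold edgeTerm
    fun_prop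
  have h2 : Continuous fun y => sqLength w (X y) c := by
    have := hX (c + 1)
    have := hX (c + 2)
    unfold sqLength
    fun_prop
  have h3 : Continuous fun y => fourArea w (X y) :=
    (continuous_const.mul (continuous_finsetSum _ fun c _ => h1 c)).sqrt
  exact (continuous_const.mul (h1 c)).div (h3.mul h2) fun y =>
    (mul_pos (fourArea_pos hw (hx y)) (sqLength_pos hw (hx y) c)).ne'

end Triangle

/-! ### Combinatorics of a triangle gluing -/

theorem fin_three_eq_of_ne {a b : Fin 3} (h : a ≠ b) : b = a + 1 ∨ b = a + 2 := by
  revert a b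
  decide

theorem Side.reverse_reverse {F : Type*} (s : Side F) : s.reverse.reverse = s := rfl

theorem Side.reverse_ne_self {F : Type*} (s : Side F) : s.reverse ≠ s := by
  intro h
  have h1 : s.2.1.2 = s.2.1.1 := congrArg (fun s : Side F => s.2.1.1) h
  exact s.2.2 h1.symm

/-- The corner of the triangle that does not lie on the given side: the labels of the three corners
add up to `0`. -/
def Side.apex {F : Type*} (s : Side F) : Fin 3 := -(s.2.1.1 + s.2.1.2)

namespace TriangleGluing

variable {F : Type*} (T : TriangleGluing F)

/-- The reversal and the gluing are commuting involutions, so the classes of directed sides modulo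
both of them are the orbits of a group of order four. -/
theorem edge_eq_iff (s s' : Side F) : T.edge s = T.edge s' ↔
    s' = s ∨ s' = s.reverse ∨ s' = T.glue s ∨ s' = (T.glue s).reverse := by
  constructor
  · intro h
    let f : T.Edge → Set (Side F) :=
      Quot.lift (fun s => {s, s.reverse, T.glue s, (T.glue s).reverse}) (by
        rintro s s' (rfl | rfl)
        · ext x
          simp only [T.glue_reverse, Side.reverse_reverse, mem_insert_iff, mem_singleton_iff]
          tauto
        · ext x
          simp only [T.glue_glue, mem_insert_iff, mem_singleton_iff]
          tauto)
    have h1 : f (T.edge s) = f (T.edge s') := congrArg f h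
    have h2 : s' ∈ f (T.edge s') := mem_insert _ _
    rw [← h1] at h2
    exact h2
  · have hrev : ∀ s, T.edge s.reverse = T.edge s := fun s =>
      (Quot.sound (r := fun s s' : Side F => s' = s.reverse ∨ s' = T.glue s) (Or.inl rfl)).symm
    have hglue : ∀ s, T.edge (T.glue s) = T.edge s := fun s =>
      (Quot.sound (r := fun s s' : Side F => s' = s.reverse ∨ s' = T.glue s) (Or.inr rfl)).symm
    rintro (rfl | rfl | rfl | rfl)
    · rfl
    · exact (hrev s).symm
    · exact (hglue s).symm
    · rw [hrev, hglue]

theorem card_side [Fintype F] : Fintype.card (Side F) = 6 * Fintype.card F := by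
  have : Fintype.card {q : Fin 3 × Fin 3 // q.1 ≠ q.2} = 6 := by decide
  rw [Fintype.card_prod, this, mul_comm]

/-- Every edge consists of four directed sides. -/
theorem four_mul_card_edge [Fintype F] : 4 * Nat.card T.Edge = 6 * Fintype.card F := by
  classical
  have : Fintype T.Edge := Fintype.ofFinite _
  rw [Nat.card_eq_fintype_card, ← card_side, ← Finset.card_univ (α := Side F),
    Finset.card_eq_sum_card_fiberwise (f := T.edge) (t := Finset.univ) (fun _ _ => by simp)]
  have h4 : ∀ e : T.Edge, (Finset.univ.filter fun s => T.edge s = e).card = 4 := by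
    intro e
    obtain ⟨s, rfl⟩ := Quot.exists_rep e
    have h1 : (Finset.univ.filter fun s' => T.edge s' = T.edge s)
        = {s, s.reverse, T.glue s, (T.glue s).reverse} := by
      ext s'
      simp only [Finset.mem_filter, Finset.mem_univ, true_and, Finset.mem_insert,
        Finset.mem_singleton]
      rw [eq_comm]
      exact T.edge_eq_iff s s'
    refine (congrArg Finset.card h1).trans ?_
    have n1 : s ≠ s.reverse := s.reverse_ne_self.symm
    have n2 : s ≠ T.glue s := (T.glue_ne_self s).symm
    have n3 : s ≠ (T.glue s).reverse := fun h => T.glue_ne_reverse s (congrArg Side.reverse h).symm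
    have n4 : s.reverse ≠ T.glue s := (T.glue_ne_reverse s).symm
    have n5 : s.reverse ≠ (T.glue s).reverse := fun h =>
      n2 (congrArg Side.reverse h)
    have n6 : T.glue s ≠ (T.glue s).reverse := (T.glue s).reverse_ne_self.symm
    rw [Finset.card_insert_of_notMem (by simp [n1, n2, n3]),
      Finset.card_insert_of_notMem (by simp [n4, n5]), Finset.card_pair n6]
  simp [h4, mul_comm]

theorem vertex_tail_glue (s : Side F) : T.vertex (T.glue s).tail = T.vertex s.tail :=
  (Quot.sound ⟨s, rfl, rfl⟩).symm

/-- On a connected surface, a function on the vertices which is constant on every triangle is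
constant: it induces a locally constant function on the surface. -/
theorem eq_of_forall_triangle [PreconnectedSpace T.Realization] {g : T.Vertex → ℝ}
    (hg : ∀ f c d, g (T.vertex (f, c)) = g (T.vertex (f, d))) (v w : T.Vertex) : g v = g w := by
  let ψ : T.Realization → ℝ := Quot.lift (fun x => g (T.vertex (x.1, 0))) (by
    rintro x y ⟨s, t, -, hx, -, hy, -⟩
    rw [hx, hy, hg s.1 0 s.2.1.1, hg (T.glue s).1 0 (T.glue s).2.1.1]
    exact congrArg g (T.vertex_tail_glue s).symm)
  have hψ : IsLocallyConstant ψ := by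
    intro U
    refine isQuotientMap_quot_mk.isOpen_preimage.1 (isOpen_sigma_iff.2 fun f => ?_)
    exact isOpen_const (p := g (T.vertex (f, 0)) ∈ U)
  obtain ⟨⟨f, c⟩, rfl⟩ := Quot.exists_rep v
  obtain ⟨⟨f', c'⟩, rfl⟩ := Quot.exists_rep w
  have x : stdSimplex ℝ (Fin 3) := ⟨Pi.single 0 1, single_mem_stdSimplex ℝ 0⟩
  have h1 : ψ (Quot.mk _ ⟨f, x⟩) = ψ (Quot.mk _ ⟨f', x⟩) :=
    hψ.apply_eq_of_preconnectedSpace (Quot.mk _ ⟨f, x⟩) (Quot.mk _ ⟨f', x⟩)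
  exact (hg f c 0).trans (Eq.trans h1 (hg f' 0 c'))

/-! ### The curvature as a function of the logarithmic radii -/

/-- The cosines of the weights of the edges of the triangle `f`, indexed by the opposite corners. -/
noncomputable def cosWeight (Φ : T.Edge → ℝ) (f : F) (c : Fin 3) : ℝ :=
  Real.cos (Φ (T.edge (Side.opposite f c)))

/-- The metric with logarithmic radii `u`. -/
noncomputable def expMetric (u : T.Vertex → ℝ) : T.Vertex → ℝ := fun v => Real.exp (u v)

/-- The conductance of the edge of the triangle `s.1` below the directed side `s`. -/
noncomputable def sideWeight (Φ : T.Edge → ℝ) (r : T.Vertex → ℝ) (s : Side F) : ℝ :=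
  conductance (T.cosWeight Φ s.1) (T.radii r s.1) s.apex

variable {T} {Φ : T.Edge → ℝ}

theorem isMetric_expMetric (u : T.Vertex → ℝ) : T.IsMetric (T.expMetric u) := fun _ =>
  Real.exp_pos _

theorem IsMetric.radii_pos {r : T.Vertex → ℝ} (hr : T.IsMetric r) (f : F) (c : Fin 3) :
    0 < T.radii r f c := hr _

theorem cosWeight_mem (hΦ : ∀ e, Φ e ∈ Icc 0 (Real.pi / 2)) (f : F) (c : Fin 3) :
    T.cosWeight Φ f c ∈ Icc (0 : ℝ) 1 :=
  ⟨Real.cos_nonneg_of_mem_Icc ⟨by linarith [(hΦ (T.edge (Side.opposite f c))).1, Real.pi_pos],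
    (hΦ _).2⟩, Real.cos_le_one _⟩

theorem angle_eq (f : F) (x : Fin 3 → ℝ) (c : Fin 3) : T.angle Φ f x c =
    Real.arccos (cosAngle (sqLength (T.cosWeight Φ f) x c) (sqLength (T.cosWeight Φ f) x (c + 1))
      (sqLength (T.cosWeight Φ f) x (c + 2))) := rfl

theorem sum_side_tail [Fintype F] (g : Side F → ℝ) (f : F) (c : Fin 3)
    [DecidablePred fun s : Side F => s.tail = (f, c)] :
    ∑ s : Side F with s.tail = (f, c), g s
      = g (f, ⟨(c, c + 1), by simp⟩) + g (f, ⟨(c, c + 2), by simp⟩) := by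
  classical
  rw [← Finset.sum_pair (f := g)
    (a := (f, ⟨(c, c + 1), by simp⟩)) (b := (f, ⟨(c, c + 2), by simp⟩)) (by simp)]
  refine Finset.sum_congr ?_ fun _ _ => rfl
  ext ⟨f', ⟨⟨a, b⟩, hab⟩⟩
  simp only [Side.tail, Finset.mem_filter, Finset.mem_univ, true_and, Prod.mk.injEq,
    Finset.mem_insert, Finset.mem_singleton, Subtype.mk.injEq]
  constructor
  · rintro ⟨rfl, rfl⟩
    simpa using fin_three_eq_of_ne hab
  · rintro (⟨rfl, rfl, rfl⟩ | ⟨rfl, rfl, rfl⟩) <;> exact ⟨rfl, rfl⟩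

theorem apex_add_one (f : F) (c : Fin 3) (h : c ≠ c + 1) :
    Side.apex ((f, ⟨(c, c + 1), h⟩) : Side F) = c + 2 := by
  change -(c + (c + 1)) = c + 2
  revert c
  decide

theorem apex_add_two (f : F) (c : Fin 3) (h : c ≠ c + 2) :
    Side.apex ((f, ⟨(c, c + 2), h⟩) : Side F) = c + 1 := by
  change -(c + (c + 2)) = c + 1
  revert c
  decide

theorem apex_opposite (f : F) (c : Fin 3) : (Side.opposite f c).apex = c := by
  change -(c + 1 + (c + 2)) = c
  revert c
  decide

/-- Thurston's formula: the derivative of an angle with respect to the radius at another corner. -/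
theorem angleDeriv_mul (hΦ : ∀ e, Φ e ∈ Icc 0 (Real.pi / 2)) {r : T.Vertex → ℝ}
    (hr : T.IsMetric r) (s : Side F) :
    T.angleDeriv Φ r s * r (T.vertex s.head) = T.sideWeight Φ r s := by
  obtain ⟨f, ⟨⟨a, b⟩, hab⟩⟩ := s
  have hab : a ≠ b := hab
  have hupd : Function.update (T.radii r f) b (T.radii r f b) = T.radii r f :=
    Function.update_eq_self _ _
  have hX : ∀ c, HasFDerivAt (fun y : ℝ => Function.update (T.radii r f) b y c)
      (ContinuousLinearMap.toSpanSingleton ℝ ((Pi.single b 1 : Fin 3 → ℝ) c)) (T.radii r f b) :=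
    fun c => (hasDerivAt_pi.1 (hasDerivAt_update (T.radii r f) b (T.radii r f b)) c).hasFDerivAt
  have h := (hasFDerivAt_angle_of_radii hX (cosWeight_mem hΦ f)
    (fun c => by rw [hupd]; exact hr.radii_pos f c) a).hasDerivAt
  have h1 : T.angleDeriv Φ r (f, ⟨(a, b), hab⟩) = _ := h.deriv
  have hb : T.radii r f b ≠ 0 := (hr.radii_pos f b).ne'
  have hba : ∀ c, c ≠ b → (Pi.single b 1 : Fin 3 → ℝ) c = 0 := fun c hc => by simp [hc]
  have hhead : r (T.vertex (Side.head (f, ⟨(a, b), hab⟩))) = T.radii r f b := rfl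
  rw [h1, hupd, hhead]
  simp only [smul_apply, add_apply, sub_apply, smul_eq_mul,
    ContinuousLinearMap.toSpanSingleton_apply, one_mul, sideWeight]
  obtain rfl | rfl := fin_three_eq_of_ne hab
  · rw [hba a hab, hba (a + 2) (by omega), apex_add_one]
    simp
    field_simp
  · rw [hba a hab, hba (a + 1) (by omega), apex_add_two]
    simp
    field_simp

theorem sideWeight_reverse (r : T.Vertex → ℝ) (s : Side F) :
    T.sideWeight Φ r s.reverse = T.sideWeight Φ r s := by
  have : s.reverse.apex = s.apex := by simp [Side.apex, Side.reverse, add_comm]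
  unfold sideWeight
  rw [this]
  rfl

theorem hasFDerivAt_angle [Fintype F] (hΦ : ∀ e, Φ e ∈ Icc 0 (Real.pi / 2)) (u : T.Vertex → ℝ)
    (k : F × Fin 3) [DecidablePred fun s : Side F => s.tail = k] :
    HasFDerivAt (fun u => T.angle Φ k.1 (T.radii (T.expMetric u) k.1) k.2)
      (∑ s : Side F with s.tail = k, T.sideWeight Φ (T.expMetric u) s
        • (ContinuousLinearMap.proj (R := ℝ) (φ := fun _ : T.Vertex => ℝ) (T.vertex s.head)
          - ContinuousLinearMap.proj (T.vertex s.tail))) u := by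
  obtain ⟨f, c⟩ := k
  have hX : ∀ c, HasFDerivAt (fun u => T.radii (T.expMetric u) f c)
      (T.radii (T.expMetric u) f c •
        ContinuousLinearMap.proj (R := ℝ) (φ := fun _ : T.Vertex => ℝ) (T.vertex (f, c))) u :=
    fun c => (hasFDerivAt_apply (𝕜 := ℝ) (T.vertex (f, c)) u).exp
  have h := hasFDerivAt_angle_of_radii hX (cosWeight_mem hΦ f)
    (fun c => (isMetric_expMetric u).radii_pos f c) c
  refine h.congr_fderiv ?_
  have hpos : ∀ c, T.radii (T.expMetric u) f c ≠ 0 := fun c =>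
    ((isMetric_expMetric u).radii_pos f c).ne'
  ext y
  simp only [sum_apply, smul_apply, add_apply, sub_apply, smul_eq_mul]
  rw [sum_side_tail]
  simp only [sideWeight, apex_add_one, apex_add_two, Side.head, Side.tail,
    inv_mul_cancel_left₀ (hpos _), ContinuousLinearMap.proj_apply]

theorem sideWeight_nonneg (hΦ : ∀ e, Φ e ∈ Icc 0 (Real.pi / 2)) {r : T.Vertex → ℝ}
    (hr : T.IsMetric r) (s : Side F) : 0 ≤ T.sideWeight Φ r s :=
  conductance_nonneg (cosWeight_mem hΦ _) (hr.radii_pos _) _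

theorem continuous_sideWeight (hΦ : ∀ e, Φ e ∈ Icc 0 (Real.pi / 2)) (s : Side F) :
    Continuous fun u => T.sideWeight Φ (T.expMetric u) s :=
  continuous_conductance (fun _ => Real.continuous_exp.comp (continuous_apply _))
    (cosWeight_mem hΦ _) (fun u => (isMetric_expMetric u).radii_pos _) _

theorem angle_mem (f : F) (x : Fin 3 → ℝ) (c : Fin 3) : T.angle Φ f x c ∈ Icc 0 Real.pi :=
  ⟨Real.arccos_nonneg _, Real.arccos_le_pi _⟩

theorem sum_angle (hΦ : ∀ e, Φ e ∈ Icc 0 (Real.pi / 2)) (f : F) {x : Fin 3 → ℝ}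
    (hx : ∀ c, 0 < x c) : ∑ c, T.angle Φ f x c = Real.pi := by
  have hw := cosWeight_mem (T := T) hΦ f
  rw [sum_fin_three _ 0]
  simp only [angle_eq, fin_three_add_one_add_one, fin_three_add_one_add_two,
    fin_three_add_two_add_one, fin_three_add_two_add_two]
  exact arccos_cosAngle_add_add (sqLength_pos hw hx _) (sqLength_pos hw hx _)
    (sqLength_pos hw hx _) (heron_sqLength_pos hw hx 0)

theorem expMetric_log {r : T.Vertex → ℝ} (hr : T.IsMetric r) :
    T.expMetric (fun v => Real.log (r v)) = r :=
  funext fun v => Real.exp_log (hr v)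

section Curvature

variable [Fintype F]

open Classical in
theorem B_eq (hΦ : ∀ e, Φ e ∈ Icc 0 (Real.pi / 2)) {r : T.Vertex → ℝ} (hr : T.IsMetric r)
    (i j : T.Vertex) : T.B Φ r i j
      = ∑ s : Side F with T.vertex s.tail = i ∧ T.vertex s.head = j, T.sideWeight Φ r s := by
  rw [B, Finset.sum_mul]
  refine Finset.sum_congr rfl fun s hs => ?_
  rw [← (Finset.mem_filter.1 hs).2.2, angleDeriv_mul hΦ hr]

/-- The combinatorial Gauss–Bonnet formula. -/
theorem sum_curvature (hΦ : ∀ e, Φ e ∈ Icc 0 (Real.pi / 2)) {r : T.Vertex → ℝ}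
    (hr : T.IsMetric r) : ∑ i, T.curvature Φ r i = 2 * Real.pi * T.eulerChar := by
  classical
  have h1 : ∑ i, ∑ c : F × Fin 3 with T.vertex c = i, T.angle Φ c.1 (T.radii r c.1) c.2
      = Fintype.card F * Real.pi := by
    have h := Finset.sum_fiberwise Finset.univ T.vertex
      fun c : F × Fin 3 => T.angle Φ c.1 (T.radii r c.1) c.2
    refine Eq.trans (by congr!) (h.trans ?_)
    rw [Fintype.sum_prod_type]
    simp only [sum_angle hΦ _ (hr.radii_pos _), Finset.sum_const, Finset.card_univ, nsmul_eq_mul]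
  have h2 : (4 : ℝ) * Nat.card T.Edge = 6 * Fintype.card F := by
    exact_mod_cast T.four_mul_card_edge
  have h3 : ∑ i, T.curvature Φ r i = Nat.card T.Vertex * (2 * Real.pi)
      - ∑ i, ∑ c : F × Fin 3 with T.vertex c = i, T.angle Φ c.1 (T.radii r c.1) c.2 := by
    simp only [curvature, Finset.sum_sub_distrib, Finset.sum_const, Finset.card_univ, nsmul_eq_mul,
      Nat.card_eq_fintype_card]
  rw [h3, h1, eulerChar]
  push_cast
  rw [Nat.card_eq_fintype_card (α := F)]
  linear_combination Real.pi / 2 * h2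

theorem hasFDerivAt_curvature (hΦ : ∀ e, Φ e ∈ Icc 0 (Real.pi / 2)) (u : T.Vertex → ℝ)
    (i : T.Vertex) : HasFDerivAt (fun u => T.curvature Φ (T.expMetric u) i)
      (-∑ j, T.B Φ (T.expMetric u) i j •
        (ContinuousLinearMap.proj (R := ℝ) (φ := fun _ : T.Vertex => ℝ) j
          - ContinuousLinearMap.proj i)) u := by
  classical
  have h := (HasFDerivAt.fun_sum (u := Finset.univ.filter fun k : F × Fin 3 => T.vertex k = i)
    fun k _ => hasFDerivAt_angle hΦ u k).const_sub (2 * Real.pi)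
  have e : (∑ k : F × Fin 3 with T.vertex k = i, ∑ s : Side F with s.tail = k,
      T.sideWeight Φ (T.expMetric u) s •
        (ContinuousLinearMap.proj (R := ℝ) (φ := fun _ : T.Vertex => ℝ) (T.vertex s.head)
          - ContinuousLinearMap.proj (T.vertex s.tail)))
      = ∑ j, T.B Φ (T.expMetric u) i j •
        (ContinuousLinearMap.proj (R := ℝ) (φ := fun _ : T.Vertex => ℝ) j
          - ContinuousLinearMap.proj i) := by
    have e1 : ∀ g : Side F → ((T.Vertex → ℝ) →L[ℝ] ℝ),
        ∑ k : F × Fin 3 with T.vertex k = i, ∑ s : Side F with s.tail = k, g s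
          = ∑ s : Side F with T.vertex s.tail = i, g s := by
      intro g
      rw [← Finset.sum_fiberwise_of_maps_to
        (s := Finset.univ.filter fun s : Side F => T.vertex s.tail = i)
        (t := Finset.univ.filter fun k : F × Fin 3 => T.vertex k = i) (g := Side.tail)
        (fun s hs => by simpa using hs)]
      refine Finset.sum_congr rfl fun k hk => ?_
      rw [Finset.filter_filter]
      refine Finset.sum_congr (Finset.filter_congr fun s _ => ?_) fun _ _ => rfl
      constructor
      · rintro rfl
        exact ⟨(Finset.mem_filter.1 hk).2, rfl⟩
      · exact fun h => h.2
    rw [e1, ← Finset.sum_fiberwise _ fun s : Side F => T.vertex s.head]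
    refine Finset.sum_congr rfl fun j _ => ?_
    rw [B_eq hΦ (isMetric_expMetric u), Finset.sum_smul, Finset.filter_filter]
    refine Finset.sum_congr (by congr!) fun s hs => ?_
    obtain ⟨h1, h2⟩ := (Finset.mem_filter.1 hs).2
    rw [h1, h2]
  rw [e] at h
  refine h.congr_of_eventuallyEq (Eventually.of_forall fun u => ?_)
  unfold curvature
  congr!

/-- The curvature of a connected surface is a curvature map in the logarithmic radii. -/
theorem isCurvatureMap [ConnectedSpace T.Realization] (hΦ : ∀ e, Φ e ∈ Icc 0 (Real.pi / 2)) :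
    IsCurvatureMap (fun u => T.curvature Φ (T.expMetric u)) (fun u => T.B Φ (T.expMetric u))
      (2 * Real.pi * (T.eulerChar : ℝ) / (Nat.card T.Vertex : ℝ)) := by
  classical
  have hexp := isMetric_expMetric (T := T)
  have hnonneg : ∀ u i j, 0 ≤ T.B Φ (T.expMetric u) i j := fun u i j => by
    rw [B_eq hΦ (hexp u)]
    exact Finset.sum_nonneg fun s _ => sideWeight_nonneg hΦ (hexp u) s
  refine ⟨fun u i j => ?_, hnonneg, fun i j => ?_, ⟨∑ _s : Side F, 10, fun u i j => ?_⟩,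
    fun u g hg => ?_, ⟨2 * Real.pi + ∑ _k : F × Fin 3, Real.pi, fun u i => ?_⟩, fun u => ?_,
    hasFDerivAt_curvature hΦ⟩
  · rw [B_eq hΦ (hexp u), B_eq hΦ (hexp u)]
    refine Finset.sum_nbij' Side.reverse Side.reverse ?_ ?_ (fun _ _ => rfl) (fun _ _ => rfl)
      fun s _ => (sideWeight_reverse _ s).symm
    all_goals
      intro s hs
      obtain ⟨h1, h2⟩ := (Finset.mem_filter.1 hs).2
      exact Finset.mem_filter.2 ⟨Finset.mem_univ _, h2, h1⟩
  · simp only [B_eq hΦ (hexp _)]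
    exact continuous_finsetSum _ fun s _ => continuous_sideWeight hΦ s
  · rw [B_eq hΦ (hexp u)]
    refine (Finset.sum_le_sum_of_subset_of_nonneg (Finset.subset_univ _)
      fun s _ _ => sideWeight_nonneg hΦ (hexp u) s).trans (Finset.sum_le_sum fun s _ => ?_)
    exact conductance_le (cosWeight_mem hΦ _) ((hexp u).radii_pos _) _
  · have hside : ∀ s : Side F, 0 < T.sideWeight Φ (T.expMetric u) s →
        g (T.vertex s.tail) = g (T.vertex s.head) := by
      intro s hs
      refine hg _ _ ?_
      rw [B_eq hΦ (hexp u)]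
      refine Finset.sum_pos' (fun s _ => sideWeight_nonneg hΦ (hexp u) s)
        ⟨s, by simp, hs⟩
    refine T.eq_of_forall_triangle fun f => ?_
    refine eq_of_forall_conductance_pos (g := fun c => g (T.vertex (f, c))) (cosWeight_mem hΦ f)
      ((hexp u).radii_pos f) fun c hc => ?_
    refine hside (Side.opposite f c) ?_
    rw [sideWeight, apex_opposite]
    exact hc
  · refine (abs_sub _ _).trans (add_le_add (abs_of_pos Real.two_pi_pos).le ?_)
    refine (Finset.abs_sum_le_sum_abs _ _).trans ?_
    refine (Finset.sum_le_sum_of_subset_of_nonneg (Finset.subset_univ _)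
      fun k _ _ => abs_nonneg _).trans (Finset.sum_le_sum fun k _ => ?_)
    rw [abs_of_nonneg (angle_mem _ _ _).1]
    exact (angle_mem _ _ _).2
  · have : Nonempty T.Vertex := by
      obtain ⟨x⟩ := (inferInstance : Nonempty T.Realization)
      obtain ⟨y, -⟩ := Quot.exists_rep x
      exact ⟨T.vertex (y.1, 0)⟩
    rw [sum_curvature hΦ (hexp u), Nat.card_eq_fintype_card]
    field_simp

theorem pLaplacian_eq (p : ℝ) (u : T.Vertex → ℝ) (i : T.Vertex) :
    T.pLaplacian Φ p (T.expMetric u) (T.curvature Φ (T.expMetric u)) i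
      = calabiField (fun u => T.curvature Φ (T.expMetric u)) (fun u => T.B Φ (T.expMetric u)) p u
        i := by
  classical
  rw [pLaplacian, calabiField, Finset.sum_filter]
  refine Finset.sum_congr rfl fun j _ => ?_
  split_ifs with h
  · rw [signedPow, mul_assoc]
  · rw [B, Finset.sum_eq_zero, zero_mul, zero_mul]
    intro s hs
    exact absurd ⟨s, (Finset.mem_filter.1 hs).2⟩ h

/-- In the logarithmic radii the flow is an autonomous equation on the whole of `ℝ^V`. -/
theorem isCalabiFlowOn_expMetric_iff {p : ℝ} {I : Set ℝ} {u : ℝ → T.Vertex → ℝ} :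
    T.IsCalabiFlowOn Φ p I (fun t => T.expMetric (u t)) ↔ ∀ t ∈ I, HasDerivWithinAt u
      (calabiField (fun u => T.curvature Φ (T.expMetric u)) (fun u => T.B Φ (T.expMetric u)) p
        (u t)) I t := by
  refine forall₂_congr fun t _ => ?_
  rw [hasDerivWithinAt_pi, and_iff_right (isMetric_expMetric _)]
  refine forall_congr' fun i => ?_
  rw [pLaplacian_eq]
  constructor
  · intro h
    have h1 := h.log (Real.exp_pos (u t i)).ne'
    simp only [expMetric, Real.log_exp] at h1
    rwa [mul_div_cancel_right₀ _ (Real.exp_pos (u t i)).ne'] at h1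
  · intro h
    rw [mul_comm]
    exact h.exp

end Curvature

end TriangleGluing

end CirclePacking

theorem mainTheorem1 {X : Type*} [TopologicalSpace X] [CompactSpace X] [ConnectedSpace X]
    [T2Space X] [ChartedSpace (EuclideanSpace ℝ (Fin 2)) X]
    {F : Type*} [Fintype F] (T : CirclePacking.GeneralizedTriangulation X F)
    (Φ : T.Edge → ℝ) (hΦ : ∀ e, Φ e ∈ Set.Icc 0 (Real.pi / 2))
    (p : ℝ) (hp : 1 < p)
    (r₀ : T.Vertex → ℝ) (hr₀ : T.IsMetric r₀) (hprod : ∏ v, r₀ v = 1) :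
    (∃ r : ℝ → T.Vertex → ℝ, r 0 = r₀ ∧ T.IsCalabiFlowOn Φ p (Set.Ici 0) r) ∧
    (∀ τ : ℝ, 0 < τ → ∀ ρ : ℝ → T.Vertex → ℝ, ρ 0 = r₀ → T.IsCalabiFlowOn Φ p (Set.Ico 0 τ) ρ →
      ∃ r : ℝ → T.Vertex → ℝ, Set.EqOn r ρ (Set.Ico 0 τ) ∧ T.IsCalabiFlowOn Φ p (Set.Ici 0) r) ∧
    (∀ r : ℝ → T.Vertex → ℝ, r 0 = r₀ → T.IsCalabiFlowOn Φ p (Set.Ici 0) r →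
      ((∃ r' : T.Vertex → ℝ, T.IsMetric r' ∧ Filter.Tendsto r Filter.atTop (nhds r')) ↔
        ∃ rav : T.Vertex → ℝ, T.IsConstantCurvature Φ rav)) := by
  open CirclePacking CirclePacking.TriangleGluing Set Filter Topology in
  have hconn : ConnectedSpace T.Realization := T.homeo.surjective.connectedSpace T.homeo.continuous
  have hK := isCurvatureMap (T := T.toTriangleGluing) hΦ
  obtain ⟨M, hM⟩ := hK.exists_norm_calabiField_le hp
  have hv := hK.continuous_calabiField hp
  -- outside `I` the values of `r` need not be positive, so `exp` and `log` cancel only on `I`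
  have hlog : ∀ {I : Set ℝ} {r : ℝ → T.Vertex → ℝ}, T.IsCalabiFlowOn Φ p I r →
      ∀ t ∈ I, HasDerivWithinAt (fun t v => Real.log (r t v))
        (calabiField (fun u => T.curvature Φ (T.expMetric u)) (fun u => T.B Φ (T.expMetric u)) p
          (fun v => Real.log (r t v))) I t := by
    intro I r hr
    refine isCalabiFlowOn_expMetric_iff.1 fun t ht => ?_
    dsimp only
    rw [expMetric_log (hr t ht).1]
    refine ⟨(hr t ht).1, fun i => ((hr t ht).2 i).congr (fun s hs => ?_) ?_⟩
    · exact congrFun (expMetric_log (hr s hs).1) i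
    · exact congrFun (expMetric_log (hr t ht).1) i
  refine ⟨?_, fun τ hτ ρ _ hρ => ?_, fun r hr0 hr => ⟨?_, ?_⟩⟩
  · obtain ⟨u, hu0, hu⟩ := exists_solution_of_continuous_of_bounded hv hM fun v => Real.log (r₀ v)
    refine ⟨fun t => T.expMetric (u t), ?_, isCalabiFlowOn_expMetric_iff.2 hu⟩
    dsimp only
    rw [hu0, expMetric_log hr₀]
  · obtain ⟨u, huρ, hu⟩ := exists_solution_extension hv hM hτ (hlog hρ)
    refine ⟨fun t => T.expMetric (u t), fun t ht => ?_, isCalabiFlowOn_expMetric_iff.2 hu⟩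
    dsimp only
    rw [huρ ht, expMetric_log (hρ t ht).1]
  · rintro ⟨r', hr', hlim⟩
    refine ⟨r', hr', fun i => ?_⟩
    have h1 : Tendsto (fun t v => Real.log (r t v)) atTop (𝓝 fun v => Real.log (r' v)) :=
      tendsto_pi_nhds.2 fun v => (tendsto_pi_nhds.1 hlim v).log (hr' v).ne'
    have h2 := hK.curv_eq_of_flow_tendsto hp (hlog hr) h1 i
    rwa [expMetric_log hr'] at h2
  · rintro ⟨rav, hrav, hcurv⟩
    have hV : (Fintype.card T.Vertex : ℝ) ≠ 0 := by
      obtain ⟨x⟩ := hconn.toNonempty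
      obtain ⟨y, -⟩ := Quot.exists_rep x
      have : Nonempty T.Vertex := ⟨T.vertex (y.1, 0)⟩
      positivity
    -- normalize `rav` to have product one
    let b : T.Vertex → ℝ := fun v => Real.log (rav v)
    let a : T.Vertex → ℝ := b + (-(∑ v, b v) / Fintype.card T.Vertex) • 1
    have ha : ∑ v, a v = 0 := by
      simp only [a, Pi.add_apply, Pi.smul_apply, Pi.one_apply, smul_eq_mul, mul_one,
        Finset.sum_add_distrib, Finset.sum_const, Finset.card_univ, nsmul_eq_mul]
      rw [mul_div_cancel₀ _ hV, add_neg_cancel]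
    have ha' : ∀ i, T.curvature Φ (T.expMetric a) i
        = 2 * Real.pi * (T.eulerChar : ℝ) / (Nat.card T.Vertex : ℝ) := fun i => by
      rw [← hcurv i]
      refine (hK.curv_add_const b _ i).trans ?_
      dsimp only [b]
      rw [expMetric_log hrav]
    have h0 : ∑ v, Real.log (r 0 v) = ∑ v, a v := by
      rw [ha, hr0, ← Real.log_prod fun v _ => (hr₀ v).ne', hprod, Real.log_one]
    have hlim := hK.tendsto_of_flow hp ha' (hlog hr) h0
    refine ⟨T.expMetric a, isMetric_expMetric a, tendsto_pi_nhds.2 fun v => ?_⟩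
    refine ((Real.continuous_exp.tendsto (a v)).comp (tendsto_pi_nhds.1 hlim v)).congr' ?_
    filter_upwards [eventually_ge_atTop 0] with t ht
    exact Real.exp_log ((hr t ht).1 v)
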